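/- Let $a<b$, write $L^1=L^1([a,b],\mathbb C)$ with norm $\|\cdot\|$, and let $\Omega_\rho(\varphi)$ be the open ball of $L^1$ with centre $\varphi$ and radius $\rho$. Let $H:[a,b]^2\to\mathbb C$ be measurable, $L:[a,b]^2\to\mathbb C$, $y\in L^1$, and let $N:\mathbb C\to\mathbb C$ be twice Fréchet differentiable. All Fréchet derivatives are taken over the real scalars (so complex differentiable maps are included, as is a function $N_0:\mathbb R\to\mathbb C$ of a real argument, through $N(z)=N_0(\operatorname{Re}z)$). Put $$K(x)(s)=\int_a^b H(s,t)L(s,t)N(x(t))\,dt,\qquad U(x)=K(x)-y .$$ For $n\ge1$ let $h_n=(b-a)/n$ and $t_{n,i}=a+ih_n$, $0\le i\le n$. For $t\in[t_{n,i-1},t_{n,i}]$, $1\le i\le n$, put $$\pi_n(x)(t)=\frac1{h_n}\int_{t_{n,i-1}}^{t_{n,i}}x(v)\,dv,\qquad [L(s,t)]_n=\frac1{h_n}\big((t_{n,i}-t)L(s,t_{n,i-1})+(t-t_{n,i-1})L(s,t_{n,i})\big),$$ $$K_n(x)(s)=\int_a^b H(s,t)[L(s,t)]_nN(\pi_n(x)(t))\,dt,\qquad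 U_n(x)=K_n(x)-y .$$ Let $\tilde f$ denote the extension of $f$ by $0$ outside $[a,b]$, and $\tilde H(\cdot,t)$ that of $H(\cdot,t)$. Put $$w_1(x,h)=\sup_{|u|\le|h|}\int_a^b|\tilde x(v+u)-\tilde x(v)|\,dv,\qquad w_2(L,h)=\sup_{u,v\in[a,b]^2,\ \|u-v\|\le|h|}|L(u)-L(v)|$$ (Euclidean norm on $\mathbb R^2$), $$w_H(h)=\sup_{t\in[a,b]}\int_a^b|\tilde H(s+h,t)-\tilde H(s,t)|\,ds,\qquad A_0(x)(s)=\int_a^b|H(s,t)|\,|N(x(t))|\,dt .$$ Let $\varphi\in L^1$ be a fixed point of $U$. Assume: (P1) $L$ is continuous on $[a,b]^2$. (P2) There are $r>0$ and positive constants $m_0,M_0,M_1,M_2,C_1,C_2,M,C$ such that - (P2.1) for all $x\in\Omega_r(\varphi)$ and all $n\ge1$, $A_0(x)$ and $A_0(\pi_n(x))$ are in $L^1$, $\|A_0(x)\|\le M_0$ and $\|A_0(\pi_n(x))\|\le m_0$; - (P2.2) $K$ is twice Fréchet differentiable on $\Omega_r(\varphi)$, with $\|K'(x)\|\le M_1$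 and $\|K''(x)\|\le M_2$ there; - (P2.3) for all sufficiently large $n$, $K_n$ is twice Fréchet differentiable on $\Omega_r(\varphi)$, $\|K_n'(\varphi)\|\le C_1$, and $\|K_n''(x)\|\le C_2$ for all $x\in\Omega_r(\varphi)$; - (P2.4) for all $x\in\Omega_r(\varphi)$ and all $n\ge1$, $\int_a^b|N(\pi_n(x)(t))|\,dt\le M$ and $\int_a^b|N(x(t))|\,dt\le C$; - (P2.5) $w_H(h)\to0$ as $h\to0$. Assume finally that $1$ is not an eigenvalue of $U'(\varphi)$. Then $\varphi$ is an isolated fixed point of $U$. Moreover, there are $\epsilon\in(0,r)$ and $n_\epsilon>0$ such that, for every $n\ge n_\epsilon$, $U_n$ has a unique fixed point $\varphi_n$ in $\Omega_\epsilon(\varphi)$, and there is a constant $\gamma>0$ such that, for all $n\ge n_\epsilon$, $$\|\varphi-\varphi_n\|\le\gamma\big(2w_2(L,h_n)\,m_0+2M_1\,w_1(\varphi,h_n)+2M_2\,w_1(\varphi,h_n)^2\big).$$ -/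

import Mathlib

open Set Filter Topology MeasureTheory
open scoped ENNReal

namespace ProductIntegration

noncomputable section

/-- Lebesgue measure on `[a,b]`. -/
abbrev intervalMeasure (a b : ℝ) : Measure ℝ := volume.restrict (Icc a b)

/-- The Banach space `L¹([a,b], ℂ)` (used as a real normed space when differentiating). -/
abbrev L1 (a b : ℝ) : Type := Lp ℂ 1 (intervalMeasure a b)

/-- The class in `L¹([a,b], ℂ)` of a function that is integrable on `[a,b]`
(and `0` for a function that is not). -/
def toL1 (a b : ℝ) (f : ℝ → ℂ) : L1 a b :=
  open Classical in if hf : MemLp f 1 (intervalMeasure a b) then hf.toLp f else 0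

/-- Extension by zero outside `[a,b]`. -/
def extendZero (a b : ℝ) (f : ℝ → ℂ) : ℝ → ℂ := (Icc a b).indicator f

/-- Oscillation of an integrable function:
`w₁(x,h) = sup_{|u| ∈ [0,|h|]} ∫_a^b |x̃(v+u) - x̃(v)| dv`. -/
def w1 (a b : ℝ) (x : L1 a b) (h : ℝ) : ℝ :=
  sSup ((fun u : ℝ => ∫ v in Icc a b, ‖extendZero a b x (v + u) - extendZero a b x v‖) ''
    {u : ℝ | |u| ∈ Icc 0 |h|})

/-- Modulus of continuity on `[a,b]²`, with the Euclidean norm of the plane: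
`w₂(f,h) = sup {|f(u) - f(v)| : u, v ∈ [a,b]², ‖u - v‖ ≤ |h|}`. -/
def w2 (a b : ℝ) (f : ℝ → ℝ → ℂ) (h : ℝ) : ℝ :=
  sSup {d : ℝ | ∃ u ∈ Icc a b ×ˢ Icc a b, ∃ v ∈ Icc a b ×ˢ Icc a b,
    √((u.1 - v.1) ^ 2 + (u.2 - v.2) ^ 2) ≤ |h| ∧ d = ‖f u.1 u.2 - f v.1 v.2‖}

/-- `w_H(h) = sup_{t ∈ [a,b]} ∫_a^b |H̃(s+h,t) - H̃(s,t)| ds`, a value in `[0,∞]`. -/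
def wH (a b : ℝ) (H : ℝ → ℝ → ℂ) (h : ℝ) : ℝ≥0∞ :=
  ⨆ t ∈ Icc a b, ∫⁻ s in Icc a b,
    ‖extendZero a b (fun σ => H σ t) (s + h) - extendZero a b (fun σ => H σ t) s‖ₑ

/-- Mesh size `h_n = (b-a)/n`. -/
def mesh (a b : ℝ) (n : ℕ) : ℝ := (b - a) / n

/-- Grid points `t_{n,i} = a + i h_n`. -/
def node (a b : ℝ) (n i : ℕ) : ℝ := a + i * mesh a b n

/-- For `n ≥ 1` and `t ∈ [a,b]`, an index `i < n` with `t ∈ [t_{n,i}, t_{n,i+1}]`. -/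
def cell (a b : ℝ) (n : ℕ) (t : ℝ) : ℕ := min ⌊(t - a) / mesh a b n⌋₊ (n - 1)

/-- Cell averages: `π_n(x)(t) = (1/h_n) ∫_{t_{n,i}}^{t_{n,i+1}} x(v) dv` for `t` in the cell
`[t_{n,i}, t_{n,i+1}]`. -/
def cellAverage (a b : ℝ) (n : ℕ) (x : L1 a b) (t : ℝ) : ℂ :=
  ((mesh a b n)⁻¹ : ℝ) *
    ∫ v in (node a b n (cell a b n t))..(node a b n (cell a b n t + 1)), x v

/-- Piecewise linear interpolation of `L(s,·)` on the grid. -/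
def interpolate (a b : ℝ) (n : ℕ) (L : ℝ → ℝ → ℂ) (s t : ℝ) : ℂ :=
  ((mesh a b n)⁻¹ : ℝ) *
    (((node a b n (cell a b n t + 1) - t : ℝ) : ℂ) * L s (node a b n (cell a b n t)) +
      ((t - node a b n (cell a b n t) : ℝ) : ℂ) * L s (node a b n (cell a b n t + 1)))

/-- `K(x)(s) = ∫_a^b H(s,t) L(s,t) N(x(t)) dt`. -/
def opK (a b : ℝ) (H L : ℝ → ℝ → ℂ) (N : ℂ → ℂ) (x : L1 a b) : L1 a b :=
  toL1 a b fun s => ∫ t in Icc a b, H s t * L s t * N (x t)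

/-- `K_n(x)(s) = ∫_a^b H(s,t) [L(s,t)]_n N(π_n(x)(t)) dt`. -/
def opKn (a b : ℝ) (H L : ℝ → ℝ → ℂ) (N : ℂ → ℂ) (n : ℕ) (x : L1 a b) : L1 a b :=
  toL1 a b fun s => ∫ t in Icc a b, H s t * interpolate a b n L s t * N (cellAverage a b n x t)

/-- `U(x) = K(x) - y`. -/
def opU (a b : ℝ) (H L : ℝ → ℝ → ℂ) (N : ℂ → ℂ) (y x : L1 a b) : L1 a b :=
  opK a b H L N x - y

/-- `U_n(x) = K_n(x) - y`. -/
def opUn (a b : ℝ) (H L : ℝ → ℝ → ℂ) (N : ℂ → ℂ) (y : L1 a b) (n : ℕ) (x : L1 a b) : L1 a b :=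
  opKn a b H L N n x - y

/-- `A₀(x)(s) = ∫_a^b |H(s,t)| |N(x(t))| dt`, a value in `[0,∞]`. -/
def opA0 (a b : ℝ) (H : ℝ → ℝ → ℂ) (N : ℂ → ℂ) (x : ℝ → ℂ) (s : ℝ) : ℝ≥0∞ :=
  ∫⁻ t in Icc a b, ‖H s t‖ₑ * ‖N (x t)‖ₑ

/-- `f` is twice Fréchet differentiable (over the reals) at every point of the open set `S`. -/
def TwiceFrechetOn {E F : Type*} [NormedAddCommGroup E] [NormedSpace ℝ E]
    [NormedAddCommGroup F] [NormedSpace ℝ F] (f : E → F) (S : Set E) : Prop :=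
  ∀ x ∈ S, DifferentiableAt ℝ f x ∧ DifferentiableAt ℝ (fderiv ℝ f) x

/-- The bounds on the kernel and on the nonlinearity over the open ball of radius `r` about `φ`. -/
structure PropertyP2 (a b : ℝ) (H L : ℝ → ℝ → ℂ) (N : ℂ → ℂ) (φ : L1 a b)
    (r m₀ M₀ M₁ M₂ C₁ C₂ M C : ℝ) : Prop where
  r_pos : 0 < r
  m₀_pos : 0 < m₀
  M₀_pos : 0 < M₀
  M₁_pos : 0 < M₁
  M₂_pos : 0 < M₂
  C₁_pos : 0 < C₁
  C₂_pos : 0 < C₂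
  M_pos : 0 < M
  C_pos : 0 < C
  /-- `A₀(x) ∈ L¹` and `‖A₀(x)‖ ≤ M₀`. -/
  A0_le : ∀ x ∈ Metric.ball φ r,
    ∫⁻ s in Icc a b, opA0 a b H N x s ≤ ENNReal.ofReal M₀
  /-- `A₀(π_n x) ∈ L¹` and `‖A₀(π_n x)‖ ≤ m₀`. -/
  A0_average_le : ∀ n : ℕ, 1 ≤ n → ∀ x ∈ Metric.ball φ r,
    ∫⁻ s in Icc a b, opA0 a b H N (cellAverage a b n x) s ≤ ENNReal.ofReal m₀
  K_twice : TwiceFrechetOn (opK a b H L N) (Metric.ball φ r)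
  K_deriv_le : ∀ x ∈ Metric.ball φ r, ‖fderiv ℝ (opK a b H L N) x‖ ≤ M₁
  K_deriv2_le : ∀ x ∈ Metric.ball φ r, ‖fderiv ℝ (fderiv ℝ (opK a b H L N)) x‖ ≤ M₂
  Kn_bounds : ∀ᶠ n : ℕ in atTop,
    TwiceFrechetOn (opKn a b H L N n) (Metric.ball φ r) ∧
    ‖fderiv ℝ (opKn a b H L N n) φ‖ ≤ C₁ ∧
    ∀ x ∈ Metric.ball φ r, ‖fderiv ℝ (fderiv ℝ (opKn a b H L N n)) x‖ ≤ C₂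
  N_average_le : ∀ n : ℕ, 1 ≤ n → ∀ x ∈ Metric.ball φ r,
    ∫⁻ t in Icc a b, ‖N (cellAverage a b n x t)‖ₑ ≤ ENNReal.ofReal M
  N_le : ∀ x ∈ Metric.ball φ r, ∫⁻ t in Icc a b, ‖N (x t)‖ₑ ≤ ENNReal.ofReal C
  wH_tendsto : Tendsto (wH a b H) (𝓝 0) (𝓝 0)

end

end ProductIntegration

open ProductIntegration

namespace ProductIntegration

section Abstract

variable {E F : Type*} [NormedAddCommGroup E] [NormedSpace ℝ E]
  [NormedAddCommGroup F] [NormedSpace ℝ F]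

/-- On a ball where the second derivative is bounded, a map differs from its linearization at the
centre by a map with small Lipschitz constant. -/
theorem TwiceFrechetOn.norm_sub_sub_fderiv_le {f : E → F} {φ : E} {r C ρ : ℝ}
    (hf : TwiceFrechetOn f (Metric.ball φ r))
    (hC : ∀ x ∈ Metric.ball φ r, ‖fderiv ℝ (fderiv ℝ f) x‖ ≤ C) (hρ : ρ ≤ r)
    {x z : E} (hx : x ∈ Metric.ball φ ρ) (hz : z ∈ Metric.ball φ ρ) :
    ‖f x - f z - fderiv ℝ f φ (x - z)‖ ≤ C * ρ * ‖x - z‖ := by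
  have hsub : Metric.ball φ ρ ⊆ Metric.ball φ r := Metric.ball_subset_ball hρ
  have hρ0 : 0 < ρ := dist_nonneg.trans_lt hx
  have hφ : φ ∈ Metric.ball φ ρ := Metric.mem_ball_self hρ0
  have hC0 : 0 ≤ C := (norm_nonneg (fderiv ℝ (fderiv ℝ f) φ)).trans (hC φ (hsub hφ))
  refine (convex_ball φ ρ).norm_image_sub_le_of_norm_fderiv_le' (𝕜 := ℝ)
    (fun w hw => (hf w (hsub hw)).1) (fun w hw => ?_) hz hx
  refine ((convex_ball φ ρ).norm_image_sub_le_of_norm_fderiv_le (𝕜 := ℝ)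
    (fun w hw => (hf w (hsub hw)).2) (fun w hw => hC w (hsub hw)) hφ hw).trans ?_
  exact mul_le_mul_of_nonneg_left (mem_ball_iff_norm.1 hw).le hC0

/-- If a bounded operator is uniformly small on the values of a map with bounded second derivative,
then it is small after the first derivative, uniformly over all such maps. -/
theorem exists_norm_comp_fderiv_le {r C ε : ℝ} (hr : 0 < r) (hC : 0 ≤ C) (hε : 0 < ε) :
    ∃ η > 0, ∀ (f : E → F) (φ : E) (Q : F →L[ℝ] F),
      TwiceFrechetOn f (Metric.ball φ r) →
      (∀ x ∈ Metric.ball φ r, ‖fderiv ℝ (fderiv ℝ f) x‖ ≤ C) → ‖Q‖ ≤ 4 →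
      (∀ x ∈ Metric.ball φ r, ‖Q (f x)‖ ≤ η) → ‖Q ∘L fderiv ℝ f φ‖ ≤ ε := by
  obtain ⟨δ, hδ0, hδr, hδ⟩ : ∃ δ > 0, δ ≤ r ∧ 8 * C * δ ≤ ε :=
    ⟨min r (ε / (8 * C + 1)), by positivity, min_le_left _ _, by
      have h1 : min r (ε / (8 * C + 1)) ≤ ε / (8 * C + 1) := min_le_right _ _
      rw [le_div_iff₀ (by positivity)] at h1
      have : 0 < min r (ε / (8 * C + 1)) := by positivity
      nlinarith⟩
  refine ⟨ε * δ / 8, by positivity, fun f φ Q hf hf2 hQ hη => ?_⟩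
  refine ContinuousLinearMap.opNorm_le_of_unit_norm hε.le fun h hh => ?_
  have hx : φ + (δ / 2) • h ∈ Metric.ball φ δ := by
    rw [mem_ball_iff_norm, add_sub_cancel_left, norm_smul, hh, Real.norm_of_nonneg (by positivity)]
    linarith
  have hφ : φ ∈ Metric.ball φ δ := Metric.mem_ball_self hδ0
  have hsub : Metric.ball φ δ ⊆ Metric.ball φ r := Metric.ball_subset_ball hδr
  have h1 := hf.norm_sub_sub_fderiv_le hf2 hδr hx hφ
  rw [add_sub_cancel_left, norm_smul, hh, Real.norm_of_nonneg (by positivity), map_smul] at h1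
  have h2 := hη _ (hsub hx)
  have h3 := hη _ (hsub hφ)
  set w := f (φ + (δ / 2) • h) - f φ - (δ / 2) • fderiv ℝ f φ h with hw
  have key : (δ / 2) • Q (fderiv ℝ f φ h) = Q (f (φ + (δ / 2) • h)) - Q (f φ) - Q w := by
    rw [hw, map_sub, map_sub, map_smul]; abel
  have h4 : ‖Q w‖ ≤ 4 * (C * δ * (δ / 2 * 1)) :=
    (Q.le_opNorm w).trans (mul_le_mul hQ h1 (norm_nonneg _) (by norm_num))
  have h5 : δ / 2 * ‖Q (fderiv ℝ f φ h)‖ ≤ ε * δ / 8 + ε * δ / 8 + 4 * (C * δ * (δ / 2 * 1)) := by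
    have h0 : δ / 2 * ‖Q (fderiv ℝ f φ h)‖ = ‖(δ / 2) • Q (fderiv ℝ f φ h)‖ := by
      rw [norm_smul, Real.norm_of_nonneg (by positivity)]
    rw [h0, key]
    refine (norm_sub_le _ _).trans (add_le_add ((norm_sub_le _ _).trans (add_le_add h2 h3)) h4)
  simp only [ContinuousLinearMap.comp_apply]
  have h6 : δ / 2 * ‖Q (fderiv ℝ f φ h)‖ ≤ δ / 2 * ε := by nlinarith
  exact le_of_mul_le_mul_left h6 (by positivity)

/-- Pointwise convergence of maps with uniformly bounded second derivatives implies pointwise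
convergence of the derivatives at the centre. -/
theorem tendsto_fderiv_apply {f : E → F} {fn : ℕ → E → F} {φ : E} {r C C' : ℝ} (hr : 0 < r)
    (hf : TwiceFrechetOn f (Metric.ball φ r))
    (hf2 : ∀ x ∈ Metric.ball φ r, ‖fderiv ℝ (fderiv ℝ f) x‖ ≤ C)
    (hfn : ∀ᶠ n in atTop, TwiceFrechetOn (fn n) (Metric.ball φ r) ∧
      ∀ x ∈ Metric.ball φ r, ‖fderiv ℝ (fderiv ℝ (fn n)) x‖ ≤ C')
    (hlim : ∀ x ∈ Metric.ball φ r, Tendsto (fun n => fn n x) atTop (𝓝 (f x))) (h : E) :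
    Tendsto (fun n => fderiv ℝ (fn n) φ h) atTop (𝓝 (fderiv ℝ f φ h)) := by
  have hφr : φ ∈ Metric.ball φ r := Metric.mem_ball_self hr
  have hC : 0 ≤ C := (norm_nonneg (fderiv ℝ (fderiv ℝ f) φ)).trans (hf2 φ hφr)
  have hC' : 0 ≤ C' := by
    obtain ⟨n, hn⟩ := hfn.exists
    exact (norm_nonneg (fderiv ℝ (fderiv ℝ (fn n)) φ)).trans (hn.2 φ hφr)
  rw [Metric.tendsto_nhds]
  intro ε hε
  set A := (C + C') * (‖h‖ + 1) ^ 2 + 1 with hA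
  have hA0 : 0 < A := by positivity
  obtain ⟨t, ht0, htr, htA⟩ : ∃ t > 0, t * (‖h‖ + 1) ≤ r ∧ A * t ≤ ε / 2 := by
    refine ⟨min (r / (‖h‖ + 1)) (ε / 2 / A), by positivity, ?_, ?_⟩
    · rw [← le_div_iff₀ (by positivity)]; exact min_le_left _ _
    · rw [mul_comm, ← le_div_iff₀ hA0]; exact min_le_right _ _
  have hx : φ + t • h ∈ Metric.ball φ (t * (‖h‖ + 1)) := by
    rw [mem_ball_iff_norm, add_sub_cancel_left, norm_smul, Real.norm_of_nonneg ht0.le]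
    nlinarith [norm_nonneg h]
  have hφ : φ ∈ Metric.ball φ (t * (‖h‖ + 1)) := Metric.mem_ball_self (by positivity)
  have h1 := hf.norm_sub_sub_fderiv_le hf2 htr hx hφ
  have e1 := Metric.tendsto_nhds.1 (hlim _ (Metric.ball_subset_ball htr hx)) (ε * t / 4)
    (by positivity)
  have e2 := Metric.tendsto_nhds.1 (hlim _ hφr) (ε * t / 4) (by positivity)
  filter_upwards [hfn, e1, e2] with n hn hn1 hn2
  have h2 := hn.1.norm_sub_sub_fderiv_le hn.2 htr hx hφ
  rw [add_sub_cancel_left, map_smul, norm_smul, Real.norm_of_nonneg ht0.le] at h1 h2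
  rw [dist_eq_norm] at hn1 hn2 ⊢
  set x := φ + t • h
  have key : t • (fderiv ℝ (fn n) φ h - fderiv ℝ f φ h) =
      (fn n x - f x) - (fn n φ - f φ) + (f x - f φ - t • fderiv ℝ f φ h)
        - (fn n x - fn n φ - t • fderiv ℝ (fn n) φ h) := by
    rw [smul_sub]; abel
  have h3 : t * ‖fderiv ℝ (fn n) φ h - fderiv ℝ f φ h‖ <
      ε * t / 4 + ε * t / 4 + C * (t * (‖h‖ + 1)) * (t * ‖h‖)
        + C' * (t * (‖h‖ + 1)) * (t * ‖h‖) := by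
    rw [← Real.norm_of_nonneg ht0.le, ← norm_smul, Real.norm_of_nonneg ht0.le, key]
    have := norm_sub_le ((fn n x - f x) - (fn n φ - f φ) + (f x - f φ - t • fderiv ℝ f φ h))
      (fn n x - fn n φ - t • fderiv ℝ (fn n) φ h)
    have := norm_add_le ((fn n x - f x) - (fn n φ - f φ)) (f x - f φ - t • fderiv ℝ f φ h)
    have := norm_sub_le (fn n x - f x) (fn n φ - f φ)
    linarith
  have h4 : C * (t * (‖h‖ + 1)) * (t * ‖h‖) + C' * (t * (‖h‖ + 1)) * (t * ‖h‖) ≤ t * (A * t) := by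
    have : (C + C') * ((‖h‖ + 1) * ‖h‖) ≤ A := by
      have : (‖h‖ + 1) * ‖h‖ ≤ (‖h‖ + 1) ^ 2 := by nlinarith [norm_nonneg h]
      have := mul_le_mul_of_nonneg_left this (add_nonneg hC hC')
      linarith
    calc _ = t * t * ((C + C') * ((‖h‖ + 1) * ‖h‖)) := by ring
      _ ≤ t * t * A := mul_le_mul_of_nonneg_left this (by positivity)
      _ = _ := by ring
  have h5 : t * ‖fderiv ℝ (fn n) φ h - fderiv ℝ f φ h‖ < t * ε := by nlinarith
  exact lt_of_mul_lt_mul_left h5 ht0.le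

/-- Pointwise convergence to `0` becomes norm convergence after composing with an operator of
finite rank. -/
theorem tendsto_norm_comp_of_finiteDimensional_range {D : ℕ → E →L[ℝ] E} {P : E →L[ℝ] E}
    (hP : FiniteDimensional ℝ (LinearMap.range P.toLinearMap))
    (hD : ∀ x, Tendsto (fun n => D n x) atTop (𝓝 0)) :
    Tendsto (fun n => ‖D n ∘L P‖) atTop (𝓝 0) := by
  let b := Module.finBasis ℝ (LinearMap.range P.toLinearMap)
  obtain ⟨c, hc, hb⟩ := b.exists_opNorm_le (F := E)
  have hsum : Tendsto (fun n => c * (∑ i, ‖D n (b i : E)‖) * ‖P‖) atTop (𝓝 0) := by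
    have : Tendsto (fun n => ∑ i, ‖D n (b i : E)‖) atTop (𝓝 (∑ _i, (0 : ℝ))) :=
      tendsto_finsetSum _ fun i _ => by simpa using (hD (b i : E)).norm
    simpa using (this.const_mul c).mul_const ‖P‖
  refine squeeze_zero (fun n => norm_nonneg _) (fun n => ?_) hsum
  have h1 : ‖D n ∘L (LinearMap.range P.toLinearMap).subtypeL‖ ≤ c * ∑ i, ‖D n (b i : E)‖ := by
    refine hb (Finset.sum_nonneg fun i _ => norm_nonneg _) fun i => ?_
    exact Finset.single_le_sum (f := fun i => ‖D n (b i : E)‖) (fun i _ => norm_nonneg _)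
      (Finset.mem_univ i)
  have h0 : 0 ≤ c * ∑ i, ‖D n (b i : E)‖ :=
    mul_nonneg hc.le (Finset.sum_nonneg fun i _ => norm_nonneg _)
  refine ContinuousLinearMap.opNorm_le_bound _ (mul_nonneg h0 (norm_nonneg _)) fun x => ?_
  have h2 := (D n ∘L (LinearMap.range P.toLinearMap).subtypeL).le_opNorm
    ⟨P x, LinearMap.mem_range_self P.toLinearMap x⟩
  refine h2.trans ?_
  rw [mul_assoc]
  exact mul_le_mul h1 (P.le_opNorm x) (norm_nonneg _) h0

/-- For operators that converge pointwise and are uniformly approximated by operators of finite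
rank, `(T_n - T) S T_n → 0` in norm. -/
theorem eventually_norm_sub_mul_mul_le {T : E →L[ℝ] E} {Tn P : ℕ → E →L[ℝ] E} {C : ℝ}
    (hlim : ∀ x, Tendsto (fun n => Tn n x) atTop (𝓝 (T x)))
    (hC : ∀ᶠ n in atTop, ‖Tn n‖ ≤ C)
    (hP : ∀ m, FiniteDimensional ℝ (LinearMap.range (P m).toLinearMap))
    (happrox : ∀ ε > 0, ∃ m, ∀ᶠ n in atTop, ‖(1 - P m) * Tn n‖ ≤ ε)
    (S : E →L[ℝ] E) {ε : ℝ} (hε : 0 < ε) :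
    ∀ᶠ n in atTop, ‖(Tn n - T) * S * Tn n‖ ≤ ε := by
  obtain ⟨n₀, hn₀⟩ := hC.exists
  have hC0 : 0 ≤ C := (norm_nonneg _).trans hn₀
  set B := (C + ‖T‖) * ‖S‖ + 1 with hB
  have hB0 : 0 < B :=
    add_pos_of_nonneg_of_pos (mul_nonneg (add_nonneg hC0 (norm_nonneg T)) (norm_nonneg S)) one_pos
  obtain ⟨m, hm⟩ := happrox (ε / 2 / B) (by positivity)
  have hD : ∀ x, Tendsto (fun n => ((Tn n - T) * S) x) atTop (𝓝 0) := fun x => by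
    have := (hlim (S x)).sub_const (T (S x))
    simpa using this
  have hF := tendsto_norm_comp_of_finiteDimensional_range (hP m) hD
  have hF' := hF.eventually_lt_const (u := ε / 2 / (C + 1)) (by positivity)
  filter_upwards [hC, hm, hF'] with n h1 h2 h3
  have key : (Tn n - T) * S * Tn n =
      ((Tn n - T) * S) * P m * Tn n + ((Tn n - T) * S) * ((1 - P m) * Tn n) := by
    noncomm_ring
  have hDB : ‖(Tn n - T) * S‖ ≤ B := by
    refine (norm_mul_le _ _).trans ?_
    have : ‖Tn n - T‖ ≤ C + ‖T‖ := (norm_sub_le _ _).trans (by linarith)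
    have := mul_le_mul_of_nonneg_right this (norm_nonneg S)
    linarith
  have h4 : ‖((Tn n - T) * S) * P m * Tn n‖ ≤ ε / 2 := by
    refine (norm_mul_le _ _).trans ?_
    calc _ ≤ ε / 2 / (C + 1) * (C + 1) :=
          mul_le_mul h3.le (by linarith) (norm_nonneg _) (by positivity)
      _ = ε / 2 := by field_simp
  have h5 : ‖((Tn n - T) * S) * ((1 - P m) * Tn n)‖ ≤ ε / 2 := by
    refine (norm_mul_le _ _).trans ?_
    calc _ ≤ B * (ε / 2 / B) := mul_le_mul hDB h2 (norm_nonneg _) hB0.le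
      _ = ε / 2 := by field_simp
  rw [key]
  exact (norm_add_le _ _).trans (by linarith)

/-- An approximate inverse criterion: if `R` inverts `1 - t` and the products `R (s - t) s`,
`(s - t) R s` are small, then `1 - s` is invertible. -/
theorem exists_inverse_one_sub {A : Type*} [NormedRing A] [CompleteSpace A]
    {t s R : A} {c : ℝ} (hone : ‖(1 : A)‖ ≤ 1) (hR1 : R * (1 - t) = 1) (hR2 : (1 - t) * R = 1)
    (h1 : ‖R * ((s - t) * s)‖ ≤ 1 / 2) (h2 : ‖(s - t) * R * s‖ ≤ 1 / 2) (hs : ‖s‖ ≤ c) :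
    ∃ V : A, V * (1 - s) = 1 ∧ (1 - s) * V = 1 ∧ ‖V‖ ≤ 2 * (1 + ‖R‖ * c) := by
  have e1 : (1 + R * s) * (1 - s) = 1 - R * ((s - t) * s) := by
    have : (1 + R * s) * (1 - s) - (1 - R * ((s - t) * s)) = (R * (1 - t) - 1) * s := by
      noncomm_ring
    rwa [hR1, sub_self, zero_mul, sub_eq_zero] at this
  have e2 : (1 - s) * (1 + R * s) = 1 - (s - t) * R * s := by
    have : (1 - s) * (1 + R * s) - (1 - (s - t) * R * s) = ((1 - t) * R - 1) * s := by
      noncomm_ring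
    rwa [hR2, sub_self, zero_mul, sub_eq_zero] at this
  obtain ⟨u, hu⟩ := isUnit_one_sub_of_norm_lt_one (h1.trans_lt (by norm_num))
  obtain ⟨v, hv⟩ := isUnit_one_sub_of_norm_lt_one (h2.trans_lt (by norm_num))
  have hl : (↑u⁻¹ * (1 + R * s)) * (1 - s) = 1 := by rw [mul_assoc, e1, ← hu, u.inv_mul]
  have hr : (1 - s) * ((1 + R * s) * ↑v⁻¹) = 1 := by rw [← mul_assoc, e2, ← hv, v.mul_inv]
  have heq := left_inv_eq_right_inv hl hr
  set V := ↑u⁻¹ * (1 + R * s) with hV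
  refine ⟨V, hl, by rw [heq]; exact hr, ?_⟩
  have e3 : V = (1 + R * s) + R * ((s - t) * s) * V := by
    have : (1 - R * ((s - t) * s)) * V = 1 + R * s := by
      rw [hV, ← hu, ← mul_assoc, u.mul_inv, one_mul]
    rw [← this]; noncomm_ring
  have h3 : ‖V‖ ≤ (1 + ‖R‖ * c) + 1 / 2 * ‖V‖ := by
    conv_lhs => rw [e3]
    refine (norm_add_le _ _).trans (add_le_add ((norm_add_le _ _).trans ?_) ?_)
    · exact add_le_add hone
        ((norm_mul_le _ _).trans (mul_le_mul_of_nonneg_left hs (norm_nonneg _)))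
    · exact (norm_mul_le _ _).trans (mul_le_mul_of_nonneg_right h1 (norm_nonneg _))
  linarith

/-- Fredholm alternative for an operator that is a norm limit of operators `P m * T` with `P m` of
finite rank. -/
theorem exists_inverse_of_not_hasEigenvalue [CompleteSpace E] {T : E →L[ℝ] E} {P : ℕ → E →L[ℝ] E}
    (hP : ∀ m, FiniteDimensional ℝ (LinearMap.range (P m).toLinearMap))
    (happrox : ∀ ε > 0, ∃ m, ‖(1 - P m) * T‖ ≤ ε)
    (h1 : ¬ Module.End.HasEigenvalue (T : E →ₗ[ℝ] E) 1) :
    ∃ R : E →L[ℝ] E, R * (1 - T) = 1 ∧ (1 - T) * R = 1 := by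
  choose m hm using fun k : ℕ => happrox (1 / ((k : ℝ) + 1)) (by positivity)
  have hlim : Tendsto (fun k => P (m k) * T) atTop (𝓝 T) := by
    rw [tendsto_iff_norm_sub_tendsto_zero]
    refine squeeze_zero (fun k => norm_nonneg _) (fun k => ?_)
      tendsto_one_div_add_atTop_nhds_zero_nat
    rw [norm_sub_rev]
    have : T - P (m k) * T = (1 - P (m k)) * T := by noncomm_ring
    rw [this]
    exact hm k
  have hcomp : IsCompactOperator T := by
    refine isCompactOperator_of_tendsto hlim (Eventually.of_forall fun k => ?_)
    have hfin := hP (m k)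
    let G : E →L[ℝ] LinearMap.range (P (m k)).toLinearMap :=
      (P (m k)).codRestrict _ (fun x => LinearMap.mem_range_self (P (m k)).toLinearMap x)
    have hloc : LocallyCompactSpace (LinearMap.range (P (m k)).toLinearMap) :=
      have := FiniteDimensional.proper_real (LinearMap.range (P (m k)).toLinearMap)
      inferInstance
    exact (isCompactOperator_of_locallyCompactSpace_dom
      (G ∘L T)).clm_comp (LinearMap.range (P (m k)).toLinearMap).subtypeL
  have hmem := (hcomp.hasEigenvalue_or_mem_resolventSet one_ne_zero).resolve_left h1
  rw [spectrum.mem_resolventSet_iff, map_one] at hmem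
  obtain ⟨u, hu⟩ := hmem
  exact ⟨↑u⁻¹, by rw [← hu, u.inv_mul], by rw [← hu, u.mul_inv]⟩

end Abstract

section AbstractFixedPoint

variable {E : Type*} [NormedAddCommGroup E] [NormedSpace ℝ E]

/-- A fixed point at which the linearization of `x - (f x - y)` is invertible is isolated. -/
theorem exists_ball_unique_fixedPoint {f : E → E} {y φ : E} {R : E →L[ℝ] E}
    (hf : DifferentiableAt ℝ f φ) (hR : R * (1 - fderiv ℝ f φ) = 1) (hφ : f φ - y = φ) :
    ∃ δ > 0, ∀ x ∈ Metric.ball φ δ, f x - y = x → x = φ := by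
  have hc : (0 : ℝ) < 1 / (2 * (‖R‖ + 1)) := by positivity
  have h1 := hf.hasFDerivAt.isLittleO.def hc
  obtain ⟨δ, hδ, h2⟩ := Metric.eventually_nhds_iff_ball.1 h1
  refine ⟨δ, hδ, fun x hx hfx => ?_⟩
  have h3 := h2 x hx
  have hd : f x - f φ = x - φ := by
    have h5 : f x - f φ = (f x - y) - (f φ - y) := by abel
    rw [h5, hfx, hφ]
  have h4 : x - φ = R (f x - f φ - fderiv ℝ f φ (x - φ)) := by
    rw [hd]
    have := DFunLike.congr_fun hR (x - φ)
    simpa using this.symm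
  have h5 : ‖x - φ‖ ≤ ‖R‖ * (1 / (2 * (‖R‖ + 1)) * ‖x - φ‖) := by
    conv_lhs => rw [h4]
    exact (R.le_opNorm _).trans (mul_le_mul_of_nonneg_left h3 (norm_nonneg _))
  have h6 : ‖R‖ * (1 / (2 * (‖R‖ + 1))) ≤ 1 / 2 := by
    rw [mul_one_div, div_le_div_iff₀ (by positivity) (by norm_num)]
    nlinarith [norm_nonneg R]
  have h7 : ‖x - φ‖ ≤ 1 / 2 * ‖x - φ‖ := by
    calc _ ≤ _ := h5
      _ = ‖R‖ * (1 / (2 * (‖R‖ + 1))) * ‖x - φ‖ := by ring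
      _ ≤ _ := mul_le_mul_of_nonneg_right h6 (norm_nonneg _)
  have h8 : ‖x - φ‖ = 0 := le_antisymm (by linarith) (norm_nonneg _)
  exact sub_eq_zero.1 (norm_eq_zero.1 h8)

/-- A simplified Newton iteration: if the linearization of `x - (f x - y)` at `φ` has an inverse of
norm at most `ρ`, the second derivative is bounded by `C`, and `f φ - y` is close enough to `φ`,
then there is exactly one fixed point in a ball whose radius depends only on `ρ` and `C`. -/
theorem existsUnique_fixedPoint_of_approximate [CompleteSpace E] {f : E → E} {y φ : E}
    {r C ρ ε : ℝ} {V : E →L[ℝ] E}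
    (hf : TwiceFrechetOn f (Metric.ball φ r))
    (hC : ∀ x ∈ Metric.ball φ r, ‖fderiv ℝ (fderiv ℝ f) x‖ ≤ C)
    (hV1 : V * (1 - fderiv ℝ f φ) = 1) (hV2 : (1 - fderiv ℝ f φ) * V = 1) (hV : ‖V‖ ≤ ρ)
    (hε : 0 < ε) (hεr : ε ≤ r) (hsmall : ρ * (C * ε) ≤ 1 / 2)
    (hres : ρ * ‖f φ - y - φ‖ ≤ ε / 4) :
    (∃! x, x ∈ Metric.ball φ ε ∧ f x - y = x) ∧
      ∀ x ∈ Metric.ball φ ε, f x - y = x → ‖φ - x‖ ≤ 2 * ρ * ‖f φ - y - φ‖ := by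
  set T := fderiv ℝ f φ with hT
  have hρ0 : 0 ≤ ρ := (norm_nonneg V).trans hV
  have hVl : ∀ x, V (x - T x) = x := fun x => by simpa using DFunLike.congr_fun hV1 x
  have hVr : ∀ x, V x - T (V x) = x := fun x => by simpa using DFunLike.congr_fun hV2 x
  let G : E → E := fun x => x - V (x - (f x - y))
  have hfix : ∀ x, G x = x ↔ f x - y = x := fun x => by
    simp only [G]
    rw [sub_eq_self]
    constructor
    · intro h
      have := hVr (x - (f x - y))
      rw [h, map_zero, sub_zero] at this
      exact (sub_eq_zero.1 this.symm).symm
    · intro h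
      rw [h, sub_self, map_zero]
  have hlip : ∀ x ∈ Metric.ball φ ε, ∀ z ∈ Metric.ball φ ε, ‖G x - G z‖ ≤ 1 / 2 * ‖x - z‖ := by
    intro x hx z hz
    have h1 := hf.norm_sub_sub_fderiv_le hC hεr hx hz
    have h2 : G x - G z = V (f x - f z - T (x - z)) := by
      have h3 : f x - f z - T (x - z) =
          ((x - z) - T (x - z)) - ((x - (f x - y)) - (z - (f z - y))) := by
        abel
      rw [h3, map_sub, hVl, map_sub]
      simp only [G]
      abel
    rw [h2]
    calc ‖V (f x - f z - T (x - z))‖ ≤ ρ * (C * ε * ‖x - z‖) :=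
          (V.le_opNorm _).trans (mul_le_mul hV h1 (norm_nonneg _) hρ0)
      _ = ρ * (C * ε) * ‖x - z‖ := by ring
      _ ≤ _ := mul_le_mul_of_nonneg_right hsmall (norm_nonneg _)
  have hGφ : ‖G φ - φ‖ ≤ ρ * ‖f φ - y - φ‖ := by
    have : G φ - φ = V (f φ - y - φ) := by
      simp only [G]
      rw [← neg_sub φ (f φ - y), map_neg]
      abel
    rw [this]
    exact (V.le_opNorm _).trans (mul_le_mul_of_nonneg_right hV (norm_nonneg _))
  have hφε : φ ∈ Metric.ball φ ε := Metric.mem_ball_self hε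
  have hsub : Metric.closedBall φ (ε / 2) ⊆ Metric.ball φ ε :=
    Metric.closedBall_subset_ball (by linarith)
  have hmaps : MapsTo G (Metric.closedBall φ (ε / 2)) (Metric.closedBall φ (ε / 2)) := by
    intro x hx
    have h1 := hlip x (hsub hx) φ hφε
    rw [mem_closedBall_iff_norm] at hx ⊢
    have h2 : G x - φ = (G x - G φ) + (G φ - φ) := by abel
    rw [h2]
    refine (norm_add_le _ _).trans ?_
    linarith
  have hcontr : ContractingWith (1 / 2) (hmaps.restrict G _ _) := by
    refine ⟨by rw [← NNReal.coe_lt_coe]; norm_num, LipschitzWith.of_dist_le_mul fun x z => ?_⟩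
    rw [Subtype.dist_eq, Subtype.dist_eq, dist_eq_norm, dist_eq_norm]
    simpa using hlip x (hsub x.2) z (hsub z.2)
  obtain ⟨x, hx, hxfix, -⟩ := ContractingWith.exists_fixedPoint'
    Metric.isClosed_closedBall.isComplete hmaps hcontr (x := φ)
    (Metric.mem_closedBall_self (by positivity)) (edist_ne_top _ _)
  refine ⟨⟨x, ⟨hsub hx, (hfix x).1 hxfix⟩, fun z hz => ?_⟩, fun z hz hzfix => ?_⟩
  · have h1 := hlip z hz.1 x (hsub hx)
    rw [(hfix z).2 hz.2, hxfix.eq] at h1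
    have h2 : ‖z - x‖ = 0 := le_antisymm (by linarith) (norm_nonneg _)
    exact sub_eq_zero.1 (norm_eq_zero.1 h2)
  · have h1 := hlip z hz φ hφε
    rw [(hfix z).2 hzfix] at h1
    have h2 : ‖z - φ‖ ≤ ‖z - G φ‖ + ‖G φ - φ‖ := norm_sub_le_norm_sub_add_norm_sub _ _ _
    rw [norm_sub_rev]
    linarith

/-- Existence, uniqueness and stability of fixed points of approximating maps that converge
pointwise, have uniformly bounded derivatives, and whose values are uniformly approximated by
operators of finite rank. -/
theorem exists_unique_fixedPoint_of_finiteRank_approx [CompleteSpace E] {K : E → E}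
    {Kn : ℕ → E → E} {P : ℕ → E →L[ℝ] E} {y φ : E} {r M₂ C₁ C₂ : ℝ} (hr : 0 < r)
    (hK : TwiceFrechetOn K (Metric.ball φ r))
    (hK2 : ∀ x ∈ Metric.ball φ r, ‖fderiv ℝ (fderiv ℝ K) x‖ ≤ M₂)
    (hKn : ∀ᶠ n in atTop, TwiceFrechetOn (Kn n) (Metric.ball φ r) ∧ ‖fderiv ℝ (Kn n) φ‖ ≤ C₁ ∧
      ∀ x ∈ Metric.ball φ r, ‖fderiv ℝ (fderiv ℝ (Kn n)) x‖ ≤ C₂)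
    (hP : ∀ m, FiniteDimensional ℝ (LinearMap.range (P m).toLinearMap))
    (hPn : ∀ m, ‖1 - P m‖ ≤ 4)
    (hPK : ∀ η > 0, ∃ m, (∀ x ∈ Metric.ball φ r, ‖(1 - P m) (K x)‖ ≤ η) ∧
      ∀ᶠ n in atTop, ∀ x ∈ Metric.ball φ r, ‖(1 - P m) (Kn n x)‖ ≤ η)
    (hlim : ∀ x ∈ Metric.ball φ r, Tendsto (fun n => Kn n x) atTop (𝓝 (K x)))
    (hφ : K φ - y = φ)
    (heig : ¬ Module.End.HasEigenvalue (fderiv ℝ K φ : E →ₗ[ℝ] E) 1) :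
    (∃ δ > 0, ∀ x ∈ Metric.ball φ δ, K x - y = x → x = φ) ∧
    ∃ ε ∈ Ioo 0 r, ∃ γ > 0, ∀ᶠ n in atTop,
      (∃! x, x ∈ Metric.ball φ ε ∧ Kn n x - y = x) ∧
      ∀ x ∈ Metric.ball φ ε, Kn n x - y = x → ‖φ - x‖ ≤ γ * ‖Kn n φ - K φ‖ := by
  have hφr : φ ∈ Metric.ball φ r := Metric.mem_ball_self hr
  have hM₂ : 0 ≤ M₂ := (norm_nonneg (fderiv ℝ (fderiv ℝ K) φ)).trans (hK2 φ hφr)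
  have hC : 0 ≤ C₁ ∧ 0 ≤ C₂ := by
    obtain ⟨n, hn⟩ := hKn.exists
    exact ⟨(norm_nonneg (fderiv ℝ (Kn n) φ)).trans hn.2.1,
      (norm_nonneg (fderiv ℝ (fderiv ℝ (Kn n)) φ)).trans (hn.2.2 φ hφr)⟩
  have happrox : ∀ ε > 0, ∃ m, ‖(1 - P m) * fderiv ℝ K φ‖ ≤ ε ∧
      ∀ᶠ n in atTop, ‖(1 - P m) * fderiv ℝ (Kn n) φ‖ ≤ ε := by
    intro ε hε
    obtain ⟨η, hη, hcomp⟩ := exists_norm_comp_fderiv_le (E := E) (F := E) hr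
      (le_max_of_le_left hM₂ : 0 ≤ max M₂ C₂) hε
    obtain ⟨m, hm, hmn⟩ := hPK η hη
    refine ⟨m, hcomp K φ (1 - P m) hK (fun x hx => (hK2 x hx).trans (le_max_left _ _))
      (hPn m) hm, ?_⟩
    filter_upwards [hKn, hmn] with n h1 h2
    exact hcomp (Kn n) φ (1 - P m) h1.1 (fun x hx => (h1.2.2 x hx).trans (le_max_right _ _))
      (hPn m) h2
  obtain ⟨R, hR1, hR2⟩ := exists_inverse_of_not_hasEigenvalue hP
    (fun ε hε => (happrox ε hε).imp fun _ h => h.1) heig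
  refine ⟨exists_ball_unique_fixedPoint (hK φ hφr).1 hR1 hφ, ?_⟩
  have hTlim := tendsto_fderiv_apply hr hK hK2 (hKn.mono fun n h => ⟨h.1, h.2.2⟩) hlim
  have hsmall := fun (S : E →L[ℝ] E) (ε : ℝ) (hε : 0 < ε) =>
    eventually_norm_sub_mul_mul_le hTlim (hKn.mono fun n h => h.2.1) hP
    (fun ε hε => (happrox ε hε).imp fun _ h => h.2) S hε
  have hone := hsmall 1 (1 / (2 * (‖R‖ + 1))) (by positivity)
  have htwo := hsmall R (1 / 2) (by norm_num)
  set ρ := 2 * (1 + ‖R‖ * C₁) with hρ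
  have hρ0 : 0 < ρ := by
    have := mul_nonneg (norm_nonneg R) hC.1
    positivity
  obtain ⟨ε, hε0, hεr, hε⟩ : ∃ ε > 0, ε < r ∧ ρ * (C₂ * ε) ≤ 1 / 2 := by
    have hC₂ := hC.2
    have hB : 0 < 2 * (ρ * C₂) + 1 := by positivity
    refine ⟨min (r / 2) (1 / (2 * (ρ * C₂) + 1)), by positivity,
      (min_le_left _ _).trans_lt (by linarith), ?_⟩
    have h1 : min (r / 2) (1 / (2 * (ρ * C₂) + 1)) ≤ 1 / (2 * (ρ * C₂) + 1) := min_le_right _ _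
    rw [le_div_iff₀ hB] at h1
    have h2 : 0 < min (r / 2) (1 / (2 * (ρ * C₂) + 1)) := by positivity
    nlinarith
  refine ⟨ε, ⟨hε0, hεr⟩, 2 * ρ, by positivity, ?_⟩
  have hres : ∀ᶠ n in atTop, ρ * ‖Kn n φ - K φ‖ ≤ ε / 4 := by
    have h1 := (tendsto_iff_norm_sub_tendsto_zero.1 (hlim φ hφr)).const_mul ρ
    rw [mul_zero] at h1
    exact h1.eventually_le_const (by positivity)
  filter_upwards [hKn, hone, htwo, hres] with n h1 h2 h3 h4
  have h5 : ‖R * ((fderiv ℝ (Kn n) φ - fderiv ℝ K φ) * fderiv ℝ (Kn n) φ)‖ ≤ 1 / 2 := by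
    rw [mul_one] at h2
    refine (norm_mul_le _ _).trans ((mul_le_mul_of_nonneg_left h2 (norm_nonneg _)).trans ?_)
    rw [mul_one_div, div_le_div_iff₀ (by positivity) (by norm_num)]
    nlinarith [norm_nonneg R]
  obtain ⟨V, hV1, hV2, hV⟩ := exists_inverse_one_sub ContinuousLinearMap.norm_id_le
    hR1 hR2 h5 h3 h1.2.1
  have h6 : Kn n φ - y - φ = Kn n φ - K φ := by
    have : Kn n φ - y - φ = Kn n φ - y - (K φ - y) := by rw [hφ]
    rw [this]; abel
  have := existsUnique_fixedPoint_of_approximate (y := y) h1.1 h1.2.2 hV1 hV2 hV hε0 hεr.le hε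
    (by rw [h6]; exact h4)
  rwa [h6] at this

end AbstractFixedPoint

section Grid

variable {a b : ℝ} {n : ℕ}

theorem mesh_pos (hab : a < b) (hn : 1 ≤ n) : 0 < mesh a b n :=
  div_pos (sub_pos.2 hab) (by exact_mod_cast hn)

theorem tendsto_mesh (a b : ℝ) : Tendsto (mesh a b) atTop (𝓝 0) :=
  tendsto_const_div_atTop_nhds_zero_nat (b - a)

theorem node_succ (a b : ℝ) (n i : ℕ) : node a b n (i + 1) = node a b n i + mesh a b n := by
  simp only [node]; push_cast; ring

theorem cell_le (a b : ℝ) (n : ℕ) (t : ℝ) : cell a b n t ≤ n - 1 := min_le_right _ _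

theorem node_mem_Icc (hab : a < b) (hn : 1 ≤ n) {i : ℕ} (hi : i ≤ n) :
    node a b n i ∈ Icc a b := by
  have h := mesh_pos hab hn
  have hn0 : (n : ℝ) ≠ 0 := by positivity
  have hb : (n : ℝ) * mesh a b n = b - a := by simp only [mesh]; field_simp
  have hi' : (i : ℝ) ≤ n := by exact_mod_cast hi
  have h1 : (i : ℝ) * mesh a b n ≤ n * mesh a b n := mul_le_mul_of_nonneg_right hi' h.le
  have h2 : 0 ≤ (i : ℝ) * mesh a b n := by positivity
  exact ⟨by simp only [node]; linarith, by simp only [node]; linarith⟩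

theorem mem_Icc_node_cell (hab : a < b) (hn : 1 ≤ n) {t : ℝ} (ht : t ∈ Icc a b) :
    t ∈ Icc (node a b n (cell a b n t)) (node a b n (cell a b n t + 1)) := by
  have h := mesh_pos hab hn
  have hn0 : (n : ℝ) ≠ 0 := by positivity
  have hb : (n : ℝ) * mesh a b n = b - a := by simp only [mesh]; field_simp
  have h0 : 0 ≤ (t - a) / mesh a b n := div_nonneg (sub_nonneg.2 ht.1) h.le
  constructor
  · have h1 : (cell a b n t : ℝ) ≤ (t - a) / mesh a b n :=
      (Nat.cast_le.2 (min_le_left _ _)).trans (Nat.floor_le h0)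
    rw [le_div_iff₀ h] at h1
    simp only [node]
    linarith
  · simp only [node]
    rcases min_choice ⌊(t - a) / mesh a b n⌋₊ (n - 1) with hc | hc
    · have h1 := (Nat.lt_floor_add_one ((t - a) / mesh a b n)).le
      rw [div_le_iff₀ h] at h1
      simp only [cell, hc]
      push_cast
      linarith
    · have h2 : n - 1 + 1 = n := by omega
      simp only [cell, hc, h2, hb]
      linarith [ht.2]

theorem Icc_node_cell_subset (hab : a < b) (hn : 1 ≤ n) (t : ℝ) :
    Icc (node a b n (cell a b n t)) (node a b n (cell a b n t + 1)) ⊆ Icc a b := by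
  have hc := cell_le a b n t
  exact Icc_subset_Icc (node_mem_Icc hab hn (by omega)).1 (node_mem_Icc hab hn (by omega)).2

theorem measurable_cell (a b : ℝ) (n : ℕ) : Measurable (cell a b n) := by
  unfold cell
  fun_prop

theorem measurable_cellAverage (a b : ℝ) (n : ℕ) (x : L1 a b) :
    Measurable (cellAverage a b n x) := by
  have : cellAverage a b n x = (fun i : ℕ => (((mesh a b n)⁻¹ : ℝ) : ℂ) *
    ∫ v in (node a b n i)..(node a b n (i + 1)), x v) ∘ cell a b n := rfl
  rw [this]
  exact (measurable_of_countable _).comp (measurable_cell a b n)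

end Grid

section IntegrableClasses

variable {a b : ℝ}

theorem toL1_coe {f : ℝ → ℂ} (hf : MemLp f 1 (intervalMeasure a b)) :
    toL1 a b f =ᵐ[intervalMeasure a b] f := by
  rw [toL1, dif_pos hf]
  exact hf.coeFn_toLp

theorem L1_enorm_eq (x : L1 a b) : ‖x‖ₑ = ∫⁻ t in Icc a b, ‖x t‖ₑ := by
  rw [Lp.enorm_def, eLpNorm_one_eq_lintegral_enorm]

theorem L1_enorm_sub_eq (x : L1 a b) {y : L1 a b} {f g : ℝ → ℂ}
    (hx : x =ᵐ[intervalMeasure a b] f) (hy : y =ᵐ[intervalMeasure a b] g) :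
    ‖x - y‖ₑ = ∫⁻ t in Icc a b, ‖f t - g t‖ₑ := by
  rw [L1_enorm_eq]
  refine lintegral_congr_ae ?_
  filter_upwards [Lp.coeFn_sub x y, hx, hy] with t h1 h2 h3
  rw [h1, Pi.sub_apply, h2, h3]

theorem L1_integrable (x : L1 a b) : IntegrableOn x (Icc a b) :=
  memLp_one_iff_integrable.1 (Lp.memLp x)

theorem L1_intervalIntegrable (x : L1 a b) {c d : ℝ} (hcd : Icc c d ⊆ Icc a b) (h : c ≤ d) :
    IntervalIntegrable x volume c d :=
  (intervalIntegrable_iff_integrableOn_Icc_of_le h).2 ((L1_integrable x).mono_set hcd)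

/-- The `L¹` distance on `[a,b]` between a function extended by zero and its translate. -/
noncomputable def translationError (a b : ℝ) (f : ℝ → ℂ) (u : ℝ) : ℝ≥0∞ :=
  ∫⁻ v in Icc a b, ‖extendZero a b f (v + u) - extendZero a b f v‖ₑ

theorem translationError_congr {f g : ℝ → ℂ} (h : f =ᵐ[intervalMeasure a b] g) (u : ℝ) :
    translationError a b f u = translationError a b g u := by
  have h1 : extendZero a b f =ᵐ[volume] extendZero a b g := by
    rw [Filter.EventuallyEq, ae_restrict_iff' measurableSet_Icc] at h
    filter_upwards [h] with v hv
    by_cases hm : v ∈ Icc a b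
    · simp [extendZero, hm, hv hm]
    · simp [extendZero, hm]
  have h2 : (fun v => extendZero a b f (v + u)) =ᵐ[volume] fun v => extendZero a b g (v + u) :=
    (measurePreserving_add_right volume u).quasiMeasurePreserving.ae_eq_comp h1
  refine lintegral_congr_ae (ae_restrict_of_ae ?_)
  filter_upwards [h1, h2] with v hv1 hv2
  rw [hv1, hv2]

theorem measurable_extendZero (x : L1 a b) : Measurable (extendZero a b x) :=
  (Lp.stronglyMeasurable x).measurable.indicator measurableSet_Icc

theorem lintegral_enorm_extendZero (x : L1 a b) : ∫⁻ t, ‖extendZero a b x t‖ₑ = ‖x‖ₑ := by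
  rw [L1_enorm_eq, ← lintegral_indicator measurableSet_Icc]
  refine lintegral_congr fun t => ?_
  by_cases hm : t ∈ Icc a b <;> simp [extendZero, hm]

theorem translationError_le (x : L1 a b) (u : ℝ) : translationError a b x u ≤ 2 * ‖x‖ₑ := by
  have hm := measurable_extendZero x
  calc translationError a b x u
      ≤ ∫⁻ v in Icc a b, (‖extendZero a b x (v + u)‖ₑ + ‖extendZero a b x v‖ₑ) :=
        lintegral_mono fun v => enorm_sub_le
    _ ≤ ∫⁻ v, (‖extendZero a b x (v + u)‖ₑ + ‖extendZero a b x v‖ₑ) := setLIntegral_le_lintegral _ _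
    _ = ‖x‖ₑ + ‖x‖ₑ := by
        rw [lintegral_add_right _ hm.enorm,
          lintegral_add_right_eq_self (fun v => ‖extendZero a b x v‖ₑ) u,
          lintegral_enorm_extendZero]
    _ = 2 * ‖x‖ₑ := (two_mul _).symm

theorem translationError_le_w1 (x : L1 a b) {h u : ℝ} (hu : |u| ≤ h) :
    translationError a b x u ≤ ENNReal.ofReal (w1 a b x h) := by
  have hm := measurable_extendZero x
  have hreal : ∀ u, ∫ v in Icc a b, ‖extendZero a b x (v + u) - extendZero a b x v‖ =
      (translationError a b x u).toReal := fun u =>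
    integral_norm_eq_lintegral_enorm
      (((hm.comp (measurable_add_const u)).sub hm).aestronglyMeasurable)
  have hfin : 2 * ‖x‖ₑ ≠ ∞ := ENNReal.mul_ne_top (by norm_num) enorm_ne_top
  rw [← ENNReal.ofReal_toReal (ne_top_of_le_ne_top hfin (translationError_le x u)), ← hreal]
  refine ENNReal.ofReal_le_ofReal (le_csSup ⟨(2 * ‖x‖ₑ).toReal, ?_⟩
    ⟨u, ⟨abs_nonneg _, hu.trans (le_abs_self h)⟩, rfl⟩)
  rintro _ ⟨v, -, rfl⟩
  simp only
  rw [hreal]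
  exact ENNReal.toReal_mono hfin (translationError_le x v)

end IntegrableClasses

section Average

variable {a b : ℝ} {n : ℕ}

theorem enorm_cellAverage_sub_le (hab : a < b) (hn : 1 ≤ n) (x : L1 a b) {t : ℝ} (c : ℂ) :
    ‖cellAverage a b n x t - c‖ₑ ≤ ENNReal.ofReal (mesh a b n)⁻¹ *
      ∫⁻ v in Ioc (node a b n (cell a b n t)) (node a b n (cell a b n t + 1)), ‖x v - c‖ₑ := by
  have h := mesh_pos hab hn
  have hle : node a b n (cell a b n t) ≤ node a b n (cell a b n t + 1) := by
    rw [node_succ]; linarith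
  have hint := L1_intervalIntegrable x (Icc_node_cell_subset hab hn t) hle
  have key : cellAverage a b n x t - c = (((mesh a b n)⁻¹ : ℝ) : ℂ) *
      ∫ v in (node a b n (cell a b n t))..(node a b n (cell a b n t + 1)), (x v - c) := by
    rw [intervalIntegral.integral_sub hint intervalIntegrable_const,
      intervalIntegral.integral_const, node_succ, add_sub_cancel_left, mul_sub, Complex.real_smul,
      ← mul_assoc, ← Complex.ofReal_mul, inv_mul_cancel₀ h.ne', Complex.ofReal_one, one_mul,
      ← node_succ]
    rfl
  rw [key, enorm_mul, intervalIntegral.integral_of_le hle]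
  gcongr
  · rw [← ofReal_norm, Complex.norm_real, Real.norm_of_nonneg (inv_nonneg.2 h.le)]
  · exact enorm_integral_le_lintegral_enorm _

theorem enorm_cellAverage_sub_self_le (hab : a < b) (hn : 1 ≤ n) (x : L1 a b) {t : ℝ}
    (ht : t ∈ Icc a b) :
    ‖cellAverage a b n x t - x t‖ₑ ≤ ENNReal.ofReal (mesh a b n)⁻¹ *
      ∫⁻ u in Icc (-mesh a b n) (mesh a b n),
        ‖extendZero a b x (t + u) - extendZero a b x t‖ₑ := by
  refine (enorm_cellAverage_sub_le hab hn x (x t)).trans (mul_le_mul' le_rfl ?_)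
  have hsub := Icc_node_cell_subset hab hn t
  have htc := mem_Icc_node_cell hab hn ht
  rw [← lintegral_indicator measurableSet_Ioc, ← lintegral_indicator measurableSet_Icc,
    ← lintegral_add_left_eq_self _ t]
  refine lintegral_mono fun u => ?_
  by_cases hu : t + u ∈ Ioc (node a b n (cell a b n t)) (node a b n (cell a b n t + 1))
  · have hu' : u ∈ Icc (-mesh a b n) (mesh a b n) := by
      rw [node_succ] at htc hu
      constructor <;> linarith [htc.1, htc.2, hu.1, hu.2]
    rw [indicator_of_mem hu, indicator_of_mem hu']
    have h1 : t + u ∈ Icc a b := hsub (Ioc_subset_Icc_self hu)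
    simp [extendZero, h1, ht]
  · rw [indicator_of_notMem hu]
    exact zero_le

/-- The cell averages are close in mean to a function with small translation errors. -/
theorem lintegral_cellAverage_sub_le (hab : a < b) (hn : 1 ≤ n) (x : L1 a b) {B : ℝ≥0∞}
    (hB : ∀ u, |u| ≤ mesh a b n → translationError a b x u ≤ B) :
    ∫⁻ t in Icc a b, ‖cellAverage a b n x t - x t‖ₑ ≤ 2 * B := by
  have h := mesh_pos hab hn
  have hm := measurable_extendZero x
  have hm2 : Measurable (Function.uncurry fun t u : ℝ =>
      ‖extendZero a b x (t + u) - extendZero a b x t‖ₑ) :=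
    ((hm.comp measurable_add).sub (hm.comp measurable_fst)).enorm
  calc ∫⁻ t in Icc a b, ‖cellAverage a b n x t - x t‖ₑ
      ≤ ∫⁻ t in Icc a b, ENNReal.ofReal (mesh a b n)⁻¹ *
          ∫⁻ u in Icc (-mesh a b n) (mesh a b n),
            ‖extendZero a b x (t + u) - extendZero a b x t‖ₑ :=
        setLIntegral_mono' measurableSet_Icc fun t ht => enorm_cellAverage_sub_self_le hab hn x ht
    _ = ENNReal.ofReal (mesh a b n)⁻¹ *
          ∫⁻ u in Icc (-mesh a b n) (mesh a b n), translationError a b x u := by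
        rw [lintegral_const_mul' _ _ ENNReal.ofReal_ne_top,
          lintegral_lintegral_swap hm2.aemeasurable]
        rfl
    _ ≤ ENNReal.ofReal (mesh a b n)⁻¹ * ∫⁻ u in Icc (-mesh a b n) (mesh a b n), B := by
        gcongr 1
        exact setLIntegral_mono' measurableSet_Icc fun u hu => hB u (abs_le.2 hu)
    _ = 2 * B := by
        rw [setLIntegral_const, Real.volume_Icc, sub_neg_eq_add, ← two_mul, mul_comm B, ← mul_assoc,
          ← ENNReal.ofReal_mul (by positivity), mul_left_comm, inv_mul_cancel₀ h.ne', mul_one]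
        norm_num

theorem memLp_step (a b : ℝ) (n : ℕ) (z : Fin (n + 1) → ℂ) :
    MemLp (fun t => z (Fin.ofNat (n + 1) (cell a b n t))) 1 (intervalMeasure a b) :=
  MemLp.of_bound ((measurable_of_countable fun i : ℕ => z (Fin.ofNat (n + 1) i)).comp
    (measurable_cell a b n)).aestronglyMeasurable (∑ i, ‖z i‖) (Eventually.of_forall fun _ =>
      Finset.single_le_sum (f := fun i => ‖z i‖) (fun _ _ => norm_nonneg _) (Finset.mem_univ _))

/-- The class in `L¹` of the step function with prescribed values on the cells. -/
noncomputable def stepFunction (a b : ℝ) (n : ℕ) : (Fin (n + 1) → ℂ) →ₗ[ℝ] L1 a b where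
  toFun z := (memLp_step a b n z).toLp _
  map_add' z w := MemLp.toLp_add (memLp_step a b n z) (memLp_step a b n w)
  map_smul' c z := MemLp.toLp_const_smul c (memLp_step a b n z)

theorem stepFunction_coe (a b : ℝ) (n : ℕ) (z : Fin (n + 1) → ℂ) :
    stepFunction a b n z =ᵐ[intervalMeasure a b] fun t => z (Fin.ofNat (n + 1) (cell a b n t)) :=
  (memLp_step a b n z).coeFn_toLp

/-- The cell averages of an integrable function, as a vector. -/
noncomputable def cellIntegrals (hab : a < b) (hn : 1 ≤ n) : L1 a b →ₗ[ℝ] Fin (n + 1) → ℂ where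
  toFun x := fun i => if (i : ℕ) < n then (((mesh a b n)⁻¹ : ℝ) : ℂ) *
    ∫ v in (node a b n i)..(node a b n (i + 1)), x v else 0
  map_add' x y := by
    ext i
    simp only [Pi.add_apply]
    split_ifs with hi
    · have hle : node a b n i ≤ node a b n (i + 1) := by
        rw [node_succ]; linarith [mesh_pos hab hn]
      have hsub : Icc (node a b n i) (node a b n (i + 1)) ⊆ Icc a b :=
        Icc_subset_Icc (node_mem_Icc hab hn (by omega)).1 (node_mem_Icc hab hn (by omega)).2
      rw [← mul_add, ← intervalIntegral.integral_add (L1_intervalIntegrable x hsub hle)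
        (L1_intervalIntegrable y hsub hle), intervalIntegral.integral_of_le hle,
        intervalIntegral.integral_of_le hle]
      congr 1
      exact integral_congr_ae (ae_restrict_of_ae_restrict_of_subset
        (Ioc_subset_Icc_self.trans hsub) (Lp.coeFn_add x y))
    · simp
  map_smul' c x := by
    ext i
    simp only [Pi.smul_apply, RingHom.id_apply]
    split_ifs with hi
    · have hle : node a b n i ≤ node a b n (i + 1) := by
        rw [node_succ]; linarith [mesh_pos hab hn]
      have hsub : Icc (node a b n i) (node a b n (i + 1)) ⊆ Icc a b :=
        Icc_subset_Icc (node_mem_Icc hab hn (by omega)).1 (node_mem_Icc hab hn (by omega)).2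
      rw [← mul_smul_comm, ← intervalIntegral.integral_smul, intervalIntegral.integral_of_le hle,
        intervalIntegral.integral_of_le hle]
      congr 1
      exact integral_congr_ae (ae_restrict_of_ae_restrict_of_subset
        (Ioc_subset_Icc_self.trans hsub) (Lp.coeFn_smul c x))
    · simp

theorem stepFunction_cellIntegrals (hab : a < b) (hn : 1 ≤ n) (x : L1 a b) :
    stepFunction a b n (cellIntegrals hab hn x) =ᵐ[intervalMeasure a b] cellAverage a b n x := by
  filter_upwards [stepFunction_coe a b n (cellIntegrals hab hn x)] with t ht
  have hc : cell a b n t < n := by have := cell_le a b n t; omega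
  have hc' : ((Fin.ofNat (n + 1) (cell a b n t) : Fin (n + 1)) : ℕ) = cell a b n t := by
    simp [Fin.ofNat, Nat.mod_eq_of_lt (show cell a b n t < n + 1 by omega)]
  rw [ht]
  simp only [cellIntegrals, LinearMap.coe_mk, AddHom.coe_mk, hc', hc, if_true]
  rfl

theorem enorm_sub_step_le (hab : a < b) (hn : 1 ≤ n) (x : L1 a b) {B : ℝ≥0∞}
    (hB : ∀ u, |u| ≤ mesh a b n → translationError a b x u ≤ B) :
    ‖stepFunction a b n (cellIntegrals hab hn x) - x‖ₑ ≤ 2 * B := by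
  rw [L1_enorm_sub_eq _ (stepFunction_cellIntegrals hab hn x) (EventuallyEq.refl _ _)]
  exact lintegral_cellAverage_sub_le hab hn x hB

theorem norm_sub_step_le (hab : a < b) (hn : 1 ≤ n) (x : L1 a b) :
    ‖stepFunction a b n (cellIntegrals hab hn x) - x‖ ≤ 4 * ‖x‖ := by
  have h := enorm_sub_step_le hab hn x (B := 2 * ‖x‖ₑ) fun u _ => translationError_le x u
  have h2 := ENNReal.toReal_mono
    (ENNReal.mul_ne_top (by norm_num) (ENNReal.mul_ne_top (by norm_num) enorm_ne_top)) h
  simp only [toReal_enorm, ENNReal.toReal_mul, ENNReal.toReal_ofNat] at h2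
  linarith

/-- Averaging over the cells of the grid, as a bounded operator on `L¹`. -/
noncomputable def averaging (hab : a < b) (hn : 1 ≤ n) : L1 a b →L[ℝ] L1 a b :=
  (stepFunction a b n ∘ₗ cellIntegrals hab hn).mkContinuous 5 fun x => by
    have h1 := norm_sub_step_le hab hn x
    have h2 := norm_sub_le_norm_sub_add_norm_sub (stepFunction a b n (cellIntegrals hab hn x)) x 0
    simp only [sub_zero] at h2
    simp only [LinearMap.comp_apply]
    linarith

theorem averaging_coe (hab : a < b) (hn : 1 ≤ n) (x : L1 a b) :
    averaging hab hn x =ᵐ[intervalMeasure a b] cellAverage a b n x :=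
  stepFunction_cellIntegrals hab hn x

theorem finiteDimensional_range_averaging (hab : a < b) (hn : 1 ≤ n) :
    FiniteDimensional ℝ (LinearMap.range (averaging hab hn).toLinearMap) :=
  Submodule.finiteDimensional_of_le
    (LinearMap.range_comp_le_range (cellIntegrals hab hn) (stepFunction a b n))

theorem norm_one_sub_averaging_le (hab : a < b) (hn : 1 ≤ n) :
    ‖1 - averaging hab hn‖ ≤ 4 := by
  refine ContinuousLinearMap.opNorm_le_bound _ (by norm_num) fun x => ?_
  have := norm_sub_step_le hab hn x
  rwa [norm_sub_rev] at this

theorem norm_one_sub_averaging_apply_le (hab : a < b) (hn : 1 ≤ n) (x : L1 a b) {B : ℝ}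
    (hB0 : 0 ≤ B) (hB : ∀ u, |u| ≤ mesh a b n → translationError a b x u ≤ ENNReal.ofReal B) :
    ‖(1 - averaging hab hn) x‖ ≤ 2 * B := by
  have h := enorm_sub_step_le hab hn x hB
  have h2 := ENNReal.toReal_mono (ENNReal.mul_ne_top (by norm_num) ENNReal.ofReal_ne_top) h
  simp only [toReal_enorm, ENNReal.toReal_mul, ENNReal.toReal_ofNat,
    ENNReal.toReal_ofReal hB0] at h2
  rwa [norm_sub_rev] at h2

theorem w1_nonneg (x : L1 a b) (h : ℝ) : 0 ≤ w1 a b x h := by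
  refine Real.sSup_nonneg ?_
  rintro _ ⟨u, -, rfl⟩
  exact integral_nonneg fun v => norm_nonneg _

theorem norm_averaging_sub_le_w1 (hab : a < b) (hn : 1 ≤ n) (x : L1 a b) :
    ‖averaging hab hn x - x‖ ≤ 2 * w1 a b x (mesh a b n) := by
  have := norm_one_sub_averaging_apply_le hab hn x (w1_nonneg x _)
    fun u hu => translationError_le_w1 x hu
  rwa [norm_sub_rev]

/-- The averaging operators converge strongly to the identity. -/
theorem tendsto_averaging (hab : a < b) (x : L1 a b) :
    Tendsto (fun n : ℕ => averaging hab (Nat.le_add_left 1 n) x) atTop (𝓝 x) := by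
  rw [tendsto_iff_norm_sub_tendsto_zero, Metric.tendsto_atTop]
  intro ε hε
  obtain ⟨g, hgs, hgx, hgc, hg⟩ := (Lp.memLp x).exists_hasCompactSupport_eLpNorm_sub_le
    ENNReal.one_ne_top (ε := ENNReal.ofReal (ε / 16)) (by simpa using hε)
  set y : L1 a b := hg.toLp g with hy
  have hyg : y =ᵐ[intervalMeasure a b] g := hg.coeFn_toLp
  have hxy : ‖x - y‖ ≤ ε / 16 := by
    have h1 : ‖x - y‖ₑ ≤ ENNReal.ofReal (ε / 16) := by
      rw [L1_enorm_sub_eq x (EventuallyEq.refl _ _) hyg, ← eLpNorm_one_eq_lintegral_enorm]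
      exact hgx
    rw [← ofReal_norm] at h1
    exact (ENNReal.ofReal_le_ofReal_iff (by positivity)).1 h1
  have huc := hgs.uniformContinuous_of_continuous hgc
  have hba : 0 < b - a := sub_pos.2 hab
  obtain ⟨δ, hδ, hgδ⟩ := Metric.uniformContinuous_iff.1 huc (ε / 4 / (b - a)) (by positivity)
  obtain ⟨n₀, hn₀⟩ := eventually_atTop.1 ((tendsto_mesh a b).eventually_lt_const hδ)
  refine ⟨n₀, fun n hn => ?_⟩
  have hn1 : 1 ≤ n + 1 := Nat.le_add_left 1 n
  have hmesh := mesh_pos hab hn1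
  have hclose : ‖averaging hab hn1 y - y‖ ≤ ε / 4 := by
    have h1 : ‖averaging hab hn1 y - y‖ₑ ≤ ENNReal.ofReal (ε / 4) := by
      rw [L1_enorm_sub_eq _ (averaging_coe hab hn1 y) (EventuallyEq.refl _ _)]
      calc ∫⁻ t in Icc a b, ‖cellAverage a b (n + 1) y t - y t‖ₑ
          ≤ ∫⁻ t in Icc a b, ENNReal.ofReal (ε / 4 / (b - a)) := by
            refine lintegral_mono_ae ?_
            filter_upwards [hyg, ae_restrict_mem measurableSet_Icc] with t hyt ht
            refine (enorm_cellAverage_sub_le hab hn1 y (y t)).trans ?_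
            have hsub := Icc_node_cell_subset hab hn1 t
            have htc := mem_Icc_node_cell hab hn1 ht
            calc _ ≤ ENNReal.ofReal (mesh a b (n + 1))⁻¹ *
                ∫⁻ v in Ioc (node a b (n + 1) (cell a b (n + 1) t))
                  (node a b (n + 1) (cell a b (n + 1) t + 1)),
                    ENNReal.ofReal (ε / 4 / (b - a)) := by
                  gcongr 1
                  refine lintegral_mono_ae ?_
                  filter_upwards [ae_restrict_of_ae_restrict_of_subset
                    (Ioc_subset_Icc_self.trans hsub) hyg, ae_restrict_mem measurableSet_Ioc]
                    with v hyv hv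
                  rw [hyv, hyt, ← ofReal_norm, ← dist_eq_norm]
                  refine ENNReal.ofReal_le_ofReal (hgδ ?_).le
                  have := hn₀ (n + 1) (by omega)
                  rw [Real.dist_eq, abs_lt]
                  rw [node_succ] at htc hv
                  constructor <;> linarith [htc.1, htc.2, hv.1, hv.2]
              _ = ENNReal.ofReal (ε / 4 / (b - a)) := by
                  rw [setLIntegral_const, Real.volume_Ioc, node_succ, add_sub_cancel_left,
                    ← ENNReal.ofReal_mul (by positivity), ← ENNReal.ofReal_mul (by positivity)]
                  congr 1
                  field_simp
        _ = ENNReal.ofReal (ε / 4) := by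
            rw [setLIntegral_const, Real.volume_Icc, ← ENNReal.ofReal_mul (by positivity)]
            congr 1
            field_simp
    rw [← ofReal_norm] at h1
    exact (ENNReal.ofReal_le_ofReal_iff (by positivity)).1 h1
  have hxy2 : ‖(1 - averaging hab hn1) (x - y)‖ ≤ 4 * (ε / 16) :=
    ((1 - averaging hab hn1).le_opNorm _).trans
      (mul_le_mul (norm_one_sub_averaging_le hab hn1) hxy (norm_nonneg _) (by norm_num))
  have hsplit : averaging hab hn1 x - x =
      (averaging hab hn1 y - y) - (1 - averaging hab hn1) (x - y) := by
    simp only [sub_apply, one_apply_eq_self, map_sub]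
    abel
  rw [Real.dist_0_eq_abs, abs_norm, hsplit]
  have := norm_sub_le (averaging hab hn1 y - y) ((1 - averaging hab hn1) (x - y))
  linarith

end Average

section Kernel

variable {a b : ℝ} {H Λ Λ' : ℝ → ℝ → ℂ} {g : ℝ → ℂ} {B ω : ℝ≥0∞}

theorem ae_mem_square (a b : ℝ) :
    ∀ᵐ p ∂(intervalMeasure a b).prod (intervalMeasure a b), p ∈ Icc a b ×ˢ Icc a b := by
  rw [Measure.prod_restrict]
  exact ae_restrict_mem (measurableSet_Icc.prod measurableSet_Icc)

theorem integrable_kernel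
    (hH : AEStronglyMeasurable (Function.uncurry H)
      ((intervalMeasure a b).prod (intervalMeasure a b)))
    (hΛ : AEStronglyMeasurable (Function.uncurry Λ)
      ((intervalMeasure a b).prod (intervalMeasure a b)))
    (hg : AEStronglyMeasurable g (intervalMeasure a b))
    (hB : B ≠ ∞) (hΛB : ∀ s ∈ Icc a b, ∀ t ∈ Icc a b, ‖Λ s t‖ₑ ≤ B)
    (hm : ∫⁻ s in Icc a b, ∫⁻ t in Icc a b, ‖H s t‖ₑ * ‖g t‖ₑ ≠ ∞) :
    Integrable (fun p : ℝ × ℝ => H p.1 p.2 * Λ p.1 p.2 * g p.2)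
      ((intervalMeasure a b).prod (intervalMeasure a b)) := by
  have hmeas : AEStronglyMeasurable (fun p : ℝ × ℝ => H p.1 p.2 * Λ p.1 p.2 * g p.2)
      ((intervalMeasure a b).prod (intervalMeasure a b)) := (hH.mul hΛ).mul hg.comp_snd
  refine ⟨hmeas, ?_⟩
  rw [hasFiniteIntegral_iff_enorm, lintegral_prod _ hmeas.enorm]
  refine lt_of_le_of_lt ?_ (ENNReal.mul_lt_top hB.lt_top hm.lt_top)
  rw [← lintegral_const_mul' _ _ hB]
  refine setLIntegral_mono' measurableSet_Icc fun s hs => ?_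
  rw [← lintegral_const_mul' _ _ hB]
  refine setLIntegral_mono' measurableSet_Icc fun t ht => ?_
  rw [enorm_mul, enorm_mul]
  calc ‖H s t‖ₑ * ‖Λ s t‖ₑ * ‖g t‖ₑ ≤ ‖H s t‖ₑ * B * ‖g t‖ₑ := by gcongr; exact hΛB s hs t ht
    _ = _ := by ring

theorem memLp_kernel
    (hint : Integrable (fun p : ℝ × ℝ => H p.1 p.2 * Λ p.1 p.2 * g p.2)
      ((intervalMeasure a b).prod (intervalMeasure a b))) :
    MemLp (fun s => ∫ t in Icc a b, H s t * Λ s t * g t) 1 (intervalMeasure a b) :=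
  memLp_one_iff_integrable.2 hint.integral_prod_left

theorem enorm_toL1_kernel_sub_le
    (hint : Integrable (fun p : ℝ × ℝ => H p.1 p.2 * Λ p.1 p.2 * g p.2)
      ((intervalMeasure a b).prod (intervalMeasure a b)))
    (hint' : Integrable (fun p : ℝ × ℝ => H p.1 p.2 * Λ' p.1 p.2 * g p.2)
      ((intervalMeasure a b).prod (intervalMeasure a b)))
    (hω : ω ≠ ∞) (hΛω : ∀ s ∈ Icc a b, ∀ t ∈ Icc a b, ‖Λ s t - Λ' s t‖ₑ ≤ ω) :
    ‖toL1 a b (fun s => ∫ t in Icc a b, H s t * Λ s t * g t) -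
      toL1 a b (fun s => ∫ t in Icc a b, H s t * Λ' s t * g t)‖ₑ ≤
      ω * ∫⁻ s in Icc a b, ∫⁻ t in Icc a b, ‖H s t‖ₑ * ‖g t‖ₑ := by
  rw [L1_enorm_sub_eq _ (toL1_coe (memLp_kernel hint)) (toL1_coe (memLp_kernel hint')),
    ← lintegral_const_mul' _ _ hω]
  refine lintegral_mono_ae ?_
  filter_upwards [hint.prod_right_ae, hint'.prod_right_ae, ae_restrict_mem measurableSet_Icc]
    with s h1 h2 hs
  rw [← integral_sub h1 h2, ← lintegral_const_mul' _ _ hω]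
  refine (enorm_integral_le_lintegral_enorm _).trans
    (setLIntegral_mono' measurableSet_Icc fun t ht => ?_)
  have : H s t * Λ s t * g t - H s t * Λ' s t * g t = H s t * (Λ s t - Λ' s t) * g t := by ring
  rw [this, enorm_mul, enorm_mul]
  calc ‖H s t‖ₑ * ‖Λ s t - Λ' s t‖ₑ * ‖g t‖ₑ ≤ ‖H s t‖ₑ * ω * ‖g t‖ₑ := by
        gcongr; exact hΛω s hs t ht
    _ = _ := by ring

theorem aestronglyMeasurable_extendZero_shift
    (hH : AEStronglyMeasurable (Function.uncurry H)
      ((intervalMeasure a b).prod (intervalMeasure a b))) (u : ℝ) :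
    AEStronglyMeasurable (fun p : ℝ × ℝ => extendZero a b (fun σ => H σ p.2) (p.1 + u))
      ((intervalMeasure a b).prod (intervalMeasure a b)) := by
  have h1 : AEStronglyMeasurable ((Icc a b ×ˢ univ).indicator (Function.uncurry H))
      ((volume : Measure ℝ).prod (intervalMeasure a b)) := by
    rw [aestronglyMeasurable_indicator_iff (measurableSet_Icc.prod MeasurableSet.univ),
      ← Measure.prod_restrict, Measure.restrict_univ]
    exact hH
  have h2 : MeasurePreserving (Prod.map (fun s : ℝ => s + u) (id : ℝ → ℝ))
      ((volume : Measure ℝ).prod (intervalMeasure a b))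
      ((volume : Measure ℝ).prod (intervalMeasure a b)) :=
    (measurePreserving_add_right volume u).prod (MeasurePreserving.id _)
  have h3 := h1.comp_quasiMeasurePreserving h2.quasiMeasurePreserving
  have h4 : (intervalMeasure a b).prod (intervalMeasure a b) ≪
      (volume : Measure ℝ).prod (intervalMeasure a b) :=
    Measure.AbsolutelyContinuous.prod Measure.restrict_le_self.absolutelyContinuous
      Measure.AbsolutelyContinuous.rfl
  refine (h3.mono_ac h4).congr (Eventually.of_forall fun p => ?_)
  by_cases hp : p.1 + u ∈ Icc a b <;> simp [extendZero, hp, Function.uncurry]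

/-- Values of an integral operator have small translation errors. -/
theorem translationError_toL1_kernel_le
    (hH : AEStronglyMeasurable (Function.uncurry H)
      ((intervalMeasure a b).prod (intervalMeasure a b)))
    (hg : AEStronglyMeasurable g (intervalMeasure a b))
    (hint : Integrable (fun p : ℝ × ℝ => H p.1 p.2 * Λ p.1 p.2 * g p.2)
      ((intervalMeasure a b).prod (intervalMeasure a b)))
    (hB : B ≠ ∞) (hΛB : ∀ s ∈ Icc a b, ∀ t ∈ Icc a b, ‖Λ s t‖ₑ ≤ B) {u : ℝ}
    (hω : ω ≠ ∞) (hΛω : ∀ s ∈ Icc a b, s + u ∈ Icc a b → ∀ t ∈ Icc a b,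
      ‖Λ (s + u) t - Λ s t‖ₑ ≤ ω) :
    translationError a b (toL1 a b (fun s => ∫ t in Icc a b, H s t * Λ s t * g t)) u ≤
      B * (wH a b H u * ∫⁻ t in Icc a b, ‖g t‖ₑ) +
        ω * ∫⁻ s in Icc a b, ∫⁻ t in Icc a b, ‖H s t‖ₑ * ‖g t‖ₑ := by
  rw [translationError_congr (toL1_coe (memLp_kernel hint))]
  set D : ℝ → ℝ → ℝ≥0∞ := fun s t =>
    ‖extendZero a b (fun σ => H σ t) (s + u) - extendZero a b (fun σ => H σ t) s‖ₑ with hD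
  have hDm : AEMeasurable (Function.uncurry D)
      ((intervalMeasure a b).prod (intervalMeasure a b)) := by
    have h0 := aestronglyMeasurable_extendZero_shift hH 0
    simp only [add_zero] at h0
    exact ((aestronglyMeasurable_extendZero_shift hH u).sub h0).enorm
  have hDgm : AEMeasurable (Function.uncurry fun s t => D s t * ‖g t‖ₑ)
      ((intervalMeasure a b).prod (intervalMeasure a b)) := hDm.mul hg.comp_snd.enorm
  have hgood := hint.prod_right_ae
  have hshift : ∀ᵐ s ∂intervalMeasure a b, s + u ∈ Icc a b →
      Integrable (fun t => H (s + u) t * Λ (s + u) t * g t) (intervalMeasure a b) := by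
    rw [ae_restrict_iff' measurableSet_Icc] at hgood
    exact ae_restrict_of_ae
      ((measurePreserving_add_right volume u).quasiMeasurePreserving.ae hgood)
  have hpt : ∀ᵐ s ∂intervalMeasure a b,
      ‖extendZero a b (fun s => ∫ t in Icc a b, H s t * Λ s t * g t) (s + u) -
        extendZero a b (fun s => ∫ t in Icc a b, H s t * Λ s t * g t) s‖ₑ ≤
      B * (∫⁻ t in Icc a b, D s t * ‖g t‖ₑ) + ω * ∫⁻ t in Icc a b, ‖H s t‖ₑ * ‖g t‖ₑ := by
    filter_upwards [hgood, hshift, ae_restrict_mem measurableSet_Icc,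
      hDgm.aestronglyMeasurable.prodMk_left]
      with s h1 h2 hs h3
    have h3' : AEMeasurable (fun t => D s t * ‖g t‖ₑ) (intervalMeasure a b) := h3.aemeasurable
    rw [← lintegral_const_mul' _ _ hB, ← lintegral_const_mul' _ _ hω,
      ← lintegral_add_left' (h3'.const_mul B)]
    by_cases hsu : s + u ∈ Icc a b
    · simp only [extendZero, indicator_of_mem hs, indicator_of_mem hsu]
      rw [← integral_sub (h2 hsu) h1]
      refine (enorm_integral_le_lintegral_enorm _).trans
        (setLIntegral_mono' measurableSet_Icc fun t ht => ?_)
      have hDst : D s t = ‖H (s + u) t - H s t‖ₑ := by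
        simp only [hD, extendZero, indicator_of_mem hs, indicator_of_mem hsu]
      have hsplit : H (s + u) t * Λ (s + u) t * g t - H s t * Λ s t * g t =
          Λ (s + u) t * ((H (s + u) t - H s t) * g t) +
            (Λ (s + u) t - Λ s t) * (H s t * g t) := by ring
      rw [hsplit, hDst]
      refine (enorm_add_le _ _).trans ?_
      rw [enorm_mul, enorm_mul, enorm_mul, enorm_mul]
      gcongr
      · exact hΛB _ hsu t ht
      · exact hΛω s hs hsu t ht
    · simp only [extendZero, indicator_of_mem hs, indicator_of_notMem hsu]
      rw [zero_sub, enorm_neg]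
      refine (enorm_integral_le_lintegral_enorm _).trans
        (setLIntegral_mono' measurableSet_Icc fun t ht => ?_)
      have hDst : D s t = ‖H s t‖ₑ := by
        simp only [hD, extendZero, indicator_of_mem hs, indicator_of_notMem hsu]
        rw [zero_sub, enorm_neg]
      rw [hDst, enorm_mul, enorm_mul]
      refine le_add_right ?_
      rw [mul_comm ‖H s t‖ₑ, mul_assoc]
      gcongr
      exact hΛB s hs t ht
  have hwH : ∫⁻ s in Icc a b, ∫⁻ t in Icc a b, D s t * ‖g t‖ₑ ≤
      wH a b H u * ∫⁻ t in Icc a b, ‖g t‖ₑ := by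
    rw [lintegral_lintegral_swap hDgm, ← lintegral_const_mul'' _ hg.enorm]
    refine setLIntegral_mono' measurableSet_Icc fun t ht => ?_
    rw [lintegral_mul_const' _ _ enorm_ne_top]
    gcongr
    exact le_iSup₂ (f := fun t (_ : t ∈ Icc a b) => ∫⁻ s in Icc a b, D s t) t ht
  refine (lintegral_mono_ae hpt).trans ?_
  have hIm : AEMeasurable (fun s => ∫⁻ t in Icc a b, D s t * ‖g t‖ₑ) (intervalMeasure a b) :=
    hDgm.lintegral_prod_right'
  rw [lintegral_add_left' (hIm.const_mul B), lintegral_const_mul' _ _ hB,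
    lintegral_const_mul' _ _ hω]
  gcongr

end Kernel

section Modulus

variable {a b : ℝ} {L : ℝ → ℝ → ℂ}

theorem exists_norm_le_of_continuousOn
    (hL : ContinuousOn (Function.uncurry L) (Icc a b ×ˢ Icc a b)) :
    ∃ B, 0 ≤ B ∧ ∀ s ∈ Icc a b, ∀ t ∈ Icc a b, ‖L s t‖ ≤ B := by
  obtain ⟨B, hB⟩ := (isCompact_Icc.prod isCompact_Icc).exists_bound_of_continuousOn hL
  exact ⟨max B 0, le_max_right _ _, fun s hs t ht => (hB (s, t) ⟨hs, ht⟩).trans (le_max_left _ _)⟩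

theorem w2_nonneg (a b : ℝ) (L : ℝ → ℝ → ℂ) (h : ℝ) : 0 ≤ w2 a b L h := by
  refine Real.sSup_nonneg ?_
  rintro _ ⟨u, -, v, -, -, rfl⟩
  exact norm_nonneg _

theorem norm_sub_le_w2 (hL : ContinuousOn (Function.uncurry L) (Icc a b ×ˢ Icc a b))
    {s t s' t' h : ℝ} (hs : s ∈ Icc a b) (ht : t ∈ Icc a b) (hs' : s' ∈ Icc a b)
    (ht' : t' ∈ Icc a b) (hd : √((s - s') ^ 2 + (t - t') ^ 2) ≤ |h|) :
    ‖L s t - L s' t'‖ ≤ w2 a b L h := by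
  obtain ⟨B, -, hB⟩ := exists_norm_le_of_continuousOn hL
  refine le_csSup ⟨B + B, ?_⟩ ⟨(s, t), ⟨hs, ht⟩, (s', t'), ⟨hs', ht'⟩, hd, rfl⟩
  rintro _ ⟨u, hu, v, hv, -, rfl⟩
  exact (norm_sub_le _ _).trans (add_le_add (hB _ hu.1 _ hu.2) (hB _ hv.1 _ hv.2))

theorem tendsto_w2 (hL : ContinuousOn (Function.uncurry L) (Icc a b ×ˢ Icc a b)) :
    Tendsto (w2 a b L) (𝓝 0) (𝓝 0) := by
  have huc := (isCompact_Icc.prod isCompact_Icc).uniformContinuousOn_of_continuous hL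
  rw [Metric.uniformContinuousOn_iff] at huc
  rw [Metric.tendsto_nhds_nhds]
  intro ε hε
  obtain ⟨δ, hδ, h1⟩ := huc (ε / 2) (by positivity)
  refine ⟨δ, hδ, fun {h} hh => ?_⟩
  rw [Real.dist_0_eq_abs] at hh ⊢
  rw [abs_of_nonneg (w2_nonneg a b L h)]
  refine lt_of_le_of_lt (Real.sSup_le ?_ (by positivity : 0 ≤ ε / 2)) (by linarith)
  rintro _ ⟨u, hu, v, hv, huv, rfl⟩
  have h2 : |u.1 - v.1| ≤ |h| := by
    refine le_trans ?_ huv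
    rw [← Real.sqrt_sq_eq_abs]
    exact Real.sqrt_le_sqrt (by nlinarith [sq_nonneg (u.2 - v.2)])
  have h3 : |u.2 - v.2| ≤ |h| := by
    refine le_trans ?_ huv
    rw [← Real.sqrt_sq_eq_abs]
    exact Real.sqrt_le_sqrt (by nlinarith [sq_nonneg (u.1 - v.1)])
  have h4 := (h1 u hu v hv (by
    rw [Prod.dist_eq, Real.dist_eq, Real.dist_eq]
    exact max_lt (h2.trans_lt hh) (h3.trans_lt hh))).le
  rwa [dist_eq_norm] at h4

end Modulus

section Interpolation

variable {a b : ℝ} {n : ℕ} {L : ℝ → ℝ → ℂ}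

theorem norm_convexCombination_le {α β M : ℝ} (hα : 0 ≤ α) (hβ : 0 ≤ β) (hαβ : α + β = 1)
    {z w : ℂ} (hz : ‖z‖ ≤ M) (hw : ‖w‖ ≤ M) : ‖(α : ℂ) * z + (β : ℂ) * w‖ ≤ M := by
  refine (norm_add_le _ _).trans ?_
  rw [norm_mul, norm_mul, Complex.norm_real, Complex.norm_real, Real.norm_of_nonneg hα,
    Real.norm_of_nonneg hβ]
  calc α * ‖z‖ + β * ‖w‖ ≤ α * M + β * M := by gcongr
    _ = M := by rw [← add_mul, hαβ, one_mul]

theorem exists_interpolate_eq (hab : a < b) (hn : 1 ≤ n) {t : ℝ} (ht : t ∈ Icc a b) :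
    ∃ α β p q : ℝ, 0 ≤ α ∧ 0 ≤ β ∧ α + β = 1 ∧ p ∈ Icc a b ∧ q ∈ Icc a b ∧
      |p - t| ≤ mesh a b n ∧ |q - t| ≤ mesh a b n ∧
      ∀ (L : ℝ → ℝ → ℂ) (s : ℝ), interpolate a b n L s t = α * L s p + β * L s q := by
  have h := mesh_pos hab hn
  have hc := cell_le a b n t
  have htc := mem_Icc_node_cell hab hn ht
  refine ⟨(mesh a b n)⁻¹ * (node a b n (cell a b n t + 1) - t),
    (mesh a b n)⁻¹ * (t - node a b n (cell a b n t)), node a b n (cell a b n t),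
    node a b n (cell a b n t + 1), mul_nonneg (inv_nonneg.2 h.le) (sub_nonneg.2 htc.2),
    mul_nonneg (inv_nonneg.2 h.le) (sub_nonneg.2 htc.1), ?_, node_mem_Icc hab hn (by omega),
    node_mem_Icc hab hn (by omega), ?_, ?_, fun L s => ?_⟩
  · rw [← mul_add, node_succ]
    field_simp
    ring
  · rw [node_succ] at htc
    rw [abs_le]; constructor <;> linarith [htc.1, htc.2]
  · rw [node_succ] at htc ⊢
    rw [abs_le]; constructor <;> linarith [htc.1, htc.2]
  · simp only [interpolate]
    push_cast
    ring

theorem norm_interpolate_le (hab : a < b) (hn : 1 ≤ n) {B : ℝ}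
    (hB : ∀ s ∈ Icc a b, ∀ t ∈ Icc a b, ‖L s t‖ ≤ B) {s t : ℝ} (hs : s ∈ Icc a b)
    (ht : t ∈ Icc a b) : ‖interpolate a b n L s t‖ ≤ B := by
  obtain ⟨α, β, p, q, hα, hβ, hαβ, hp, hq, -, -, h⟩ := exists_interpolate_eq hab hn ht
  rw [h]
  exact norm_convexCombination_le hα hβ hαβ (hB s hs p hp) (hB s hs q hq)

theorem norm_interpolate_sub_le_w2 (hab : a < b) (hn : 1 ≤ n)
    (hL : ContinuousOn (Function.uncurry L) (Icc a b ×ˢ Icc a b)) {s t : ℝ} (hs : s ∈ Icc a b)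
    (ht : t ∈ Icc a b) : ‖interpolate a b n L s t - L s t‖ ≤ w2 a b L (mesh a b n) := by
  obtain ⟨α, β, p, q, hα, hβ, hαβ, hp, hq, hpt, hqt, h⟩ := exists_interpolate_eq hab hn ht
  have hαβ' : (α : ℂ) + β = 1 := by exact_mod_cast hαβ
  have : interpolate a b n L s t - L s t =
      α * (L s p - L s t) + β * (L s q - L s t) := by
    rw [h]
    linear_combination (L s t) * hαβ'
  rw [this]
  have hd : ∀ x, |x - t| ≤ mesh a b n → √((s - s) ^ 2 + (x - t) ^ 2) ≤ |mesh a b n| := by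
    intro x hx
    rw [sub_self, zero_pow two_ne_zero, zero_add, Real.sqrt_sq_eq_abs]
    exact hx.trans (le_abs_self _)
  exact norm_convexCombination_le hα hβ hαβ (norm_sub_le_w2 hL hs hp hs ht (hd p hpt))
    (norm_sub_le_w2 hL hs hq hs ht (hd q hqt))

theorem norm_sub_left_le_w2 (hL : ContinuousOn (Function.uncurry L) (Icc a b ×ˢ Icc a b))
    {s u t : ℝ} (hs : s ∈ Icc a b) (hsu : s + u ∈ Icc a b) (ht : t ∈ Icc a b) :
    ‖L (s + u) t - L s t‖ ≤ w2 a b L u := by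
  refine norm_sub_le_w2 hL hsu ht hs ht ?_
  rw [add_sub_cancel_left, sub_self, zero_pow two_ne_zero, add_zero, Real.sqrt_sq_eq_abs]

theorem norm_interpolate_sub_left_le_w2 (hab : a < b) (hn : 1 ≤ n)
    (hL : ContinuousOn (Function.uncurry L) (Icc a b ×ˢ Icc a b))
    {s u t : ℝ} (hs : s ∈ Icc a b) (hsu : s + u ∈ Icc a b) (ht : t ∈ Icc a b) :
    ‖interpolate a b n L (s + u) t - interpolate a b n L s t‖ ≤ w2 a b L u := by
  obtain ⟨α, β, p, q, hα, hβ, hαβ, hp, hq, -, -, h⟩ := exists_interpolate_eq hab hn ht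
  have : interpolate a b n L (s + u) t - interpolate a b n L s t =
      α * (L (s + u) p - L s p) + β * (L (s + u) q - L s q) := by
    rw [h, h]; ring
  rw [this]
  exact norm_convexCombination_le hα hβ hαβ (norm_sub_left_le_w2 hL hs hsu hp)
    (norm_sub_left_le_w2 hL hs hsu hq)

theorem aestronglyMeasurable_uncurry_of_continuousOn
    (hL : ContinuousOn (Function.uncurry L) (Icc a b ×ˢ Icc a b)) :
    AEStronglyMeasurable (Function.uncurry L)
      ((intervalMeasure a b).prod (intervalMeasure a b)) := by
  rw [Measure.prod_restrict]
  exact hL.aestronglyMeasurable (measurableSet_Icc.prod measurableSet_Icc)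

theorem aestronglyMeasurable_interpolate (hab : a < b) (hn : 1 ≤ n)
    (hL : ContinuousOn (Function.uncurry L) (Icc a b ×ˢ Icc a b)) :
    AEStronglyMeasurable (Function.uncurry (interpolate a b n L))
      ((intervalMeasure a b).prod (intervalMeasure a b)) := by
  let G : ℝ × ℝ → ℂ := fun p => L (projIcc a b hab.le p.1) (projIcc a b hab.le p.2)
  have hG : Continuous G := by
    refine hL.comp_continuous
      (f := fun p : ℝ × ℝ => ((projIcc a b hab.le p.1 : ℝ), (projIcc a b hab.le p.2 : ℝ)))
      ?_ fun p => ⟨(projIcc a b hab.le p.1).2, (projIcc a b hab.le p.2).2⟩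
    exact (continuous_subtype_val.comp (continuous_projIcc.comp continuous_fst)).prodMk
      (continuous_subtype_val.comp (continuous_projIcc.comp continuous_snd))
  have hnode : ∀ k : ℕ, Measurable fun p : ℝ × ℝ => node a b n (cell a b n p.2 + k) := fun k =>
    (measurable_of_countable fun i : ℕ => node a b n (i + k)).comp
      ((measurable_cell a b n).comp measurable_snd)
  have hGk : ∀ k : ℕ, Measurable fun p : ℝ × ℝ => G (p.1, node a b n (cell a b n p.2 + k)) :=
    fun k => hG.measurable.comp (measurable_fst.prodMk (hnode k))
  have hmeas : Measurable (Function.uncurry (interpolate a b n fun s t => G (s, t))) := by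
    refine Measurable.const_mul (((Complex.measurable_ofReal.comp
      ((hnode 1).sub measurable_snd)).mul (hGk 0)).add ((Complex.measurable_ofReal.comp
      (measurable_snd.sub (hnode 0))).mul (hGk 1))) _
  refine hmeas.aestronglyMeasurable.congr ?_
  filter_upwards [ae_mem_square a b] with p hp
  obtain ⟨α, β, x, y, -, -, -, hx, hy, -, -, h⟩ := exists_interpolate_eq hab hn hp.2
  simp only [Function.uncurry, h, G, projIcc_of_mem hab.le hp.1, projIcc_of_mem hab.le hx,
    projIcc_of_mem hab.le hy]

end Interpolation

section Operators

variable {a b : ℝ} {H L : ℝ → ℝ → ℂ} {N : ℂ → ℂ} {φ : L1 a b} {n : ℕ} {B m : ℝ}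

theorem enorm_le_ofReal {E : Type*} [SeminormedAddCommGroup E] {z : E} {B : ℝ} (h : ‖z‖ ≤ B) :
    ‖z‖ₑ ≤ ENNReal.ofReal B := by
  rw [← ofReal_norm]
  exact ENNReal.ofReal_le_ofReal h

theorem integrable_opK
    (hH : AEStronglyMeasurable (Function.uncurry H)
      ((intervalMeasure a b).prod (intervalMeasure a b)))
    (hL : ContinuousOn (Function.uncurry L) (Icc a b ×ˢ Icc a b))
    (hB : ∀ s ∈ Icc a b, ∀ t ∈ Icc a b, ‖L s t‖ ≤ B)
    {g : ℝ → ℂ} (hg : AEStronglyMeasurable (fun t => N (g t)) (intervalMeasure a b))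
    (hm : ∫⁻ s in Icc a b, opA0 a b H N g s ≤ ENNReal.ofReal m) :
    Integrable (fun p : ℝ × ℝ => H p.1 p.2 * L p.1 p.2 * N (g p.2))
      ((intervalMeasure a b).prod (intervalMeasure a b)) :=
  integrable_kernel hH (aestronglyMeasurable_uncurry_of_continuousOn hL) hg ENNReal.ofReal_ne_top
    (fun s hs t ht => enorm_le_ofReal (hB s hs t ht))
    (ne_top_of_le_ne_top ENNReal.ofReal_ne_top hm)

theorem integrable_opKn (hab : a < b) (hn : 1 ≤ n)
    (hH : AEStronglyMeasurable (Function.uncurry H)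
      ((intervalMeasure a b).prod (intervalMeasure a b)))
    (hL : ContinuousOn (Function.uncurry L) (Icc a b ×ˢ Icc a b))
    (hB : ∀ s ∈ Icc a b, ∀ t ∈ Icc a b, ‖L s t‖ ≤ B)
    {g : ℝ → ℂ} (hg : AEStronglyMeasurable (fun t => N (g t)) (intervalMeasure a b))
    (hm : ∫⁻ s in Icc a b, opA0 a b H N g s ≤ ENNReal.ofReal m) :
    Integrable (fun p : ℝ × ℝ => H p.1 p.2 * interpolate a b n L p.1 p.2 * N (g p.2))
      ((intervalMeasure a b).prod (intervalMeasure a b)) :=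
  integrable_kernel hH (aestronglyMeasurable_interpolate hab hn hL) hg ENNReal.ofReal_ne_top
    (fun _ hs _ ht => enorm_le_ofReal (norm_interpolate_le hab hn hB hs ht))
    (ne_top_of_le_ne_top ENNReal.ofReal_ne_top hm)

theorem aestronglyMeasurable_comp_L1 (hN : Continuous N) (x : L1 a b) :
    AEStronglyMeasurable (fun t => N (x t)) (intervalMeasure a b) :=
  hN.comp_aestronglyMeasurable (Lp.aestronglyMeasurable x)

theorem aestronglyMeasurable_comp_cellAverage (hN : Continuous N) (n : ℕ) (x : L1 a b) :
    AEStronglyMeasurable (fun t => N (cellAverage a b n x t)) (intervalMeasure a b) :=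
  hN.comp_aestronglyMeasurable (measurable_cellAverage a b n x).aestronglyMeasurable

theorem opK_averaging (hab : a < b) (hn : 1 ≤ n) (x : L1 a b) :
    opK a b H L N (averaging hab hn x) =
      toL1 a b fun s => ∫ t in Icc a b, H s t * L s t * N (cellAverage a b n x t) := by
  unfold opK
  congr 1
  ext s
  refine integral_congr_ae ?_
  filter_upwards [averaging_coe hab hn x] with t ht
  rw [ht]

/-- The product integration error for a kernel, after averaging the unknown function. -/
theorem norm_opKn_sub_opK_averaging_le (hab : a < b) (hn : 1 ≤ n)
    (hH : AEStronglyMeasurable (Function.uncurry H)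
      ((intervalMeasure a b).prod (intervalMeasure a b)))
    (hL : ContinuousOn (Function.uncurry L) (Icc a b ×ˢ Icc a b)) (hN : Continuous N)
    {x : L1 a b} (hm0 : 0 ≤ m)
    (hm : ∫⁻ s in Icc a b, opA0 a b H N (cellAverage a b n x) s ≤ ENNReal.ofReal m) :
    ‖opKn a b H L N n x - opK a b H L N (averaging hab hn x)‖ ≤ w2 a b L (mesh a b n) * m := by
  obtain ⟨B, -, hB⟩ := exists_norm_le_of_continuousOn hL
  have hg := aestronglyMeasurable_comp_cellAverage (N := N) hN n x
  have h := enorm_toL1_kernel_sub_le (Λ := interpolate a b n L) (Λ' := L)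
    (g := fun t => N (cellAverage a b n x t)) (integrable_opKn hab hn hH hL hB hg hm)
    (integrable_opK hH hL hB hg hm) ENNReal.ofReal_ne_top
    (fun s hs t ht => enorm_le_ofReal (norm_interpolate_sub_le_w2 hab hn hL hs ht))
  have h2 := h.trans (mul_le_mul' le_rfl hm)
  rw [← ENNReal.ofReal_mul (w2_nonneg a b L _)] at h2
  rw [opK_averaging]
  rw [← ofReal_norm] at h2
  exact (ENNReal.ofReal_le_ofReal_iff (mul_nonneg (w2_nonneg a b L _) hm0)).1 h2

variable {r m₀ M₀ M₁ M₂ C₁ C₂ M C : ℝ}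

theorem norm_opK_averaging_sub_le (hP2 : PropertyP2 a b H L N φ r m₀ M₀ M₁ M₂ C₁ C₂ M C)
    (hab : a < b) (hn : 1 ≤ n) (hφ : averaging hab hn φ ∈ Metric.ball φ r) :
    ‖opK a b H L N (averaging hab hn φ) - opK a b H L N φ‖ ≤
      M₁ * (2 * w1 a b φ (mesh a b n)) :=
  ((convex_ball φ r).norm_image_sub_le_of_norm_fderiv_le (𝕜 := ℝ)
    (fun x hx => (hP2.K_twice x hx).1) hP2.K_deriv_le (Metric.mem_ball_self hP2.r_pos) hφ).trans
    (mul_le_mul_of_nonneg_left (norm_averaging_sub_le_w1 hab hn φ) hP2.M₁_pos.le)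

theorem tendsto_opKn (hP2 : PropertyP2 a b H L N φ r m₀ M₀ M₁ M₂ C₁ C₂ M C) (hab : a < b)
    (hH : AEStronglyMeasurable (Function.uncurry H)
      ((intervalMeasure a b).prod (intervalMeasure a b)))
    (hL : ContinuousOn (Function.uncurry L) (Icc a b ×ˢ Icc a b)) (hN : Continuous N)
    {x : L1 a b} (hx : x ∈ Metric.ball φ r) :
    Tendsto (fun n => opKn a b H L N n x) atTop (𝓝 (opK a b H L N x)) := by
  rw [← tendsto_add_atTop_iff_nat 1]
  have h1 : Tendsto (fun n : ℕ => opK a b H L N (averaging hab (Nat.le_add_left 1 n) x)) atTop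
      (𝓝 (opK a b H L N x)) :=
    (hP2.K_twice x hx).1.continuousAt.tendsto.comp (tendsto_averaging hab x)
  have h2 : Tendsto (fun n : ℕ => opKn a b H L N (n + 1) x -
      opK a b H L N (averaging hab (Nat.le_add_left 1 n) x)) atTop (𝓝 0) := by
    refine squeeze_zero_norm (fun n => norm_opKn_sub_opK_averaging_le hab (Nat.le_add_left 1 n)
      hH hL hN hP2.m₀_pos.le (hP2.A0_average_le (n + 1) (Nat.le_add_left 1 n) x hx)) ?_
    have h3 := ((tendsto_w2 hL).comp (tendsto_mesh a b)).comp (tendsto_add_atTop_nat 1)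
    simpa using h3.mul_const m₀
  simpa using h2.add h1

/-- The values of the operators on the ball are uniformly approximated by their averages. -/
theorem exists_averaging_opK_le (hP2 : PropertyP2 a b H L N φ r m₀ M₀ M₁ M₂ C₁ C₂ M C)
    (hab : a < b)
    (hH : AEStronglyMeasurable (Function.uncurry H)
      ((intervalMeasure a b).prod (intervalMeasure a b)))
    (hL : ContinuousOn (Function.uncurry L) (Icc a b ×ˢ Icc a b)) (hN : Continuous N)
    {η : ℝ} (hη : 0 < η) :
    ∃ k : ℕ, (∀ x ∈ Metric.ball φ r,
        ‖(1 - averaging hab (Nat.le_add_left 1 k)) (opK a b H L N x)‖ ≤ η) ∧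
      ∀ n, 1 ≤ n → ∀ x ∈ Metric.ball φ r,
        ‖(1 - averaging hab (Nat.le_add_left 1 k)) (opKn a b H L N n x)‖ ≤ η := by
  obtain ⟨B, -, hB⟩ := exists_norm_le_of_continuousOn hL
  have hlim : ∀ c m : ℝ, Tendsto (fun u => ENNReal.ofReal B * (wH a b H u * ENNReal.ofReal c) +
      ENNReal.ofReal (w2 a b L u) * ENNReal.ofReal m) (𝓝 0) (𝓝 0) := fun c m => by
    have h1 := ENNReal.Tendsto.const_mul (ENNReal.Tendsto.mul_const hP2.wH_tendsto
      (b := ENNReal.ofReal c) (Or.inr ENNReal.ofReal_ne_top)) (a := ENNReal.ofReal B)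
      (Or.inr ENNReal.ofReal_ne_top)
    have h2 := ENNReal.Tendsto.mul_const (ENNReal.tendsto_ofReal (tendsto_w2 hL))
      (b := ENNReal.ofReal m) (Or.inr ENNReal.ofReal_ne_top)
    simpa using h1.add h2
  have hη2 : (0 : ℝ≥0∞) < ENNReal.ofReal (η / 2) := ENNReal.ofReal_pos.2 (by positivity)
  obtain ⟨δ, hδ, hδu⟩ := Metric.eventually_nhds_iff.1
    (((hlim C M₀).eventually_le_const hη2).and ((hlim M m₀).eventually_le_const hη2))
  obtain ⟨k, hk⟩ := (((tendsto_mesh a b).comp (tendsto_add_atTop_nat 1)).eventually_lt_const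
    hδ).exists
  have hu : ∀ u, |u| ≤ mesh a b (k + 1) → dist u 0 < δ := fun u hu => by
    rw [Real.dist_0_eq_abs]
    exact hu.trans_lt hk
  have hηeq : 2 * (η / 2) = η := by ring
  refine ⟨k, fun x hx => ?_, fun n hn x hx => ?_⟩
  · rw [← hηeq]
    refine norm_one_sub_averaging_apply_le hab (Nat.le_add_left 1 k) _ (by positivity)
      fun u hud => le_trans ?_ (hδu (hu u hud)).1
    have hg := aestronglyMeasurable_comp_L1 hN x
    refine (translationError_toL1_kernel_le hH hg
      (integrable_opK hH hL hB hg (hP2.A0_le x hx)) ENNReal.ofReal_ne_top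
      (fun s hs t ht => enorm_le_ofReal (hB s hs t ht)) ENNReal.ofReal_ne_top
      (fun s hs hsu t ht => enorm_le_ofReal
        (norm_sub_left_le_w2 hL hs hsu ht))).trans ?_
    gcongr
    · exact hP2.N_le x hx
    · exact hP2.A0_le x hx
  · rw [← hηeq]
    refine norm_one_sub_averaging_apply_le hab (Nat.le_add_left 1 k) _ (by positivity)
      fun u hud => le_trans ?_ (hδu (hu u hud)).2
    have hg := aestronglyMeasurable_comp_cellAverage hN n x
    refine (translationError_toL1_kernel_le hH hg
      (integrable_opKn hab hn hH hL hB hg (hP2.A0_average_le n hn x hx)) ENNReal.ofReal_ne_top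
      (fun s hs t ht => enorm_le_ofReal (norm_interpolate_le hab hn hB hs ht))
      ENNReal.ofReal_ne_top
      (fun s hs hsu t ht => enorm_le_ofReal
        (norm_interpolate_sub_left_le_w2 hab hn hL hs hsu ht))).trans ?_
    gcongr
    · exact hP2.N_average_le n hn x hx
    · exact hP2.A0_average_le n hn x hx

end Operators

end ProductIntegration

theorem theorem3 (a b : ℝ) (hab : a < b)
    (H L : ℝ → ℝ → ℂ) (N : ℂ → ℂ) (y φ : L1 a b)
    (hH : AEStronglyMeasurable (Function.uncurry H)
      ((intervalMeasure a b).prod (intervalMeasure a b)))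
    (hN : TwiceFrechetOn N Set.univ)
    (hL : ContinuousOn (Function.uncurry L) (Set.Icc a b ×ˢ Set.Icc a b))
    (r m₀ M₀ M₁ M₂ C₁ C₂ M C : ℝ)
    (hP2 : PropertyP2 a b H L N φ r m₀ M₀ M₁ M₂ C₁ C₂ M C)
    (hφ : opU a b H L N y φ = φ)
    (heig : ¬ Module.End.HasEigenvalue
      (fderiv ℝ (opU a b H L N y) φ : L1 a b →ₗ[ℝ] L1 a b) 1) :
    (∃ δ > 0, ∀ x ∈ Metric.ball φ δ, opU a b H L N y x = x → x = φ) ∧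
    ∃ ε ∈ Set.Ioo 0 r, ∃ nε : ℕ, 0 < nε ∧
      (∀ n ≥ nε, ∃! φn : L1 a b, φn ∈ Metric.ball φ ε ∧ opUn a b H L N y n φn = φn) ∧
      ∃ γ > 0, ∀ n ≥ nε, ∀ φn ∈ Metric.ball φ ε, opUn a b H L N y n φn = φn →
        ‖φ - φn‖ ≤ γ * (2 * w2 a b L (mesh a b n) * m₀ + 2 * M₁ * w1 a b φ (mesh a b n) +
          2 * M₂ * w1 a b φ (mesh a b n) ^ 2) := by
  have hNc : Continuous N := continuous_iff_continuousAt.2 fun z =>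
    (hN z (mem_univ z)).1.continuousAt
  have hderiv : fderiv ℝ (opU a b H L N y) φ = fderiv ℝ (opK a b H L N) φ :=
    fderiv_sub_const y
  rw [hderiv] at heig
  obtain ⟨hiso, ε, hε, γ, hγ, hev⟩ := exists_unique_fixedPoint_of_finiteRank_approx
    (P := fun k : ℕ => averaging hab (Nat.le_add_left 1 k)) hP2.r_pos
    hP2.K_twice hP2.K_deriv2_le hP2.Kn_bounds
    (fun k => finiteDimensional_range_averaging hab (Nat.le_add_left 1 k))
    (fun k => norm_one_sub_averaging_le hab (Nat.le_add_left 1 k))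
    (fun η hη => (exists_averaging_opK_le hP2 hab hH hL hNc hη).imp fun k hk =>
      ⟨hk.1, (eventually_ge_atTop 1).mono fun n hn => hk.2 n hn⟩)
    (fun x hx => tendsto_opKn hP2 hab hH hL hNc hx) hφ heig
  refine ⟨hiso, ε, hε, ?_⟩
  have hball : ∀ᶠ n : ℕ in atTop,
      averaging hab (Nat.le_add_left 1 n) φ ∈ Metric.ball φ r :=
    (tendsto_averaging hab φ).eventually (Metric.ball_mem_nhds φ hP2.r_pos)
  obtain ⟨n₁, hn₁⟩ := eventually_atTop.1 hev
  obtain ⟨n₂, hn₂⟩ := eventually_atTop.1 hball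
  refine ⟨max n₁ (n₂ + 1), by positivity,
    fun n hn => (hn₁ n ((le_max_left _ _).trans hn)).1, γ, hγ, fun n hn φn hφn hfix => ?_⟩
  refine ((hn₁ n ((le_max_left _ _).trans hn)).2 φn hφn hfix).trans
    (mul_le_mul_of_nonneg_left ?_ hγ.le)
  have hn2 : n₂ + 1 ≤ n := (le_max_right _ _).trans hn
  obtain ⟨k, rfl⟩ : ∃ k, n = k + 1 := ⟨n - 1, by omega⟩
  have hk : 1 ≤ k + 1 := Nat.le_add_left 1 k
  have hφr : φ ∈ Metric.ball φ r := Metric.mem_ball_self hP2.r_pos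
  have h1 := norm_opKn_sub_opK_averaging_le hab hk hH hL hNc hP2.m₀_pos.le
    (hP2.A0_average_le (k + 1) hk φ hφr)
  have h2 := norm_opK_averaging_sub_le hP2 hab hk (hn₂ k (by omega))
  have h3 := norm_sub_le_norm_sub_add_norm_sub (opKn a b H L N (k + 1) φ)
    (opK a b H L N (averaging hab hk φ)) (opK a b H L N φ)
  have h4 : 0 ≤ w2 a b L (mesh a b (k + 1)) * m₀ := mul_nonneg (w2_nonneg _ _ _ _) hP2.m₀_pos.le
  have h5 : 0 ≤ M₂ * w1 a b φ (mesh a b (k + 1)) ^ 2 := mul_nonneg hP2.M₂_pos.le (sq_nonneg _)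
  linarith
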